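/- A cardinal $\kappa$ is \emph{measurable} if it is uncountable and there is a non-principal $\kappa$-complete ultrafilter over $\kappa$. Let $\kappa$ be a measurable cardinal and let $\alpha\geq\omega$ be an ordinal. We say that $\kappa$ has the \emph{$\alpha$-Gluing Property} ($\alpha$-$\mathrm{GP}$) if for every sequence $\langle U_\beta\mid\beta<\alpha\rangle$ of non-principal $\kappa$-complete ultrafilters over $\kappa$ there are a transitive class $M$, a (first-order definable, with parameters) elementary embedding $j\colon V\to M$ with $\mathrm{crit}(j)=\kappa$ and $M^{\kappa}\subseteq M$, and a strictly increasing sequence of ordinals $\langle\eta_\beta\mid\beta<\alpha\rangle$ such that $$U_\beta=\{X\subseteq\kappa\mid \eta_\beta\in j(X)\}\qquad\text{for all }\beta<\alpha .$$ We say that $\kappa$ has the \emph{${<}\alpha$-$\mathrm{GP}$} if $\kappa$ has the $\beta$-$\mathrm{GP}$ for all ordinals $\beta$ with $\omega\leq\beta<\alpha$. \textbf{Lemma.} Suppose that $\kappa\leq\lambda$ are measurable cardinals. If $\kappa$ has the ${<}\lambda$-$\mathrm{GP}$, then $\kappa$ has the ${<}\lambda^{+}$-$\mathrm{GP}$. In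 particular, if $\kappa$ is measurable and has the ${<}\kappa$-$\mathrm{GP}$, then $\kappa$ has the ${<}\kappa^{+}$-$\mathrm{GP}$. -/

import Mathlib

universe u

namespace Gluing

open FirstOrder Cardinal

/-! ### Measurable cardinals -/

/-- `U` is a non-principal `κ`-complete ultrafilter over `κ`, where `κ` is regarded as the set
`Set.Iio κ.ord` of all ordinals below its initial ordinal. -/
def IsNonprincipalComplete (κ : Cardinal.{u}) (U : Ultrafilter (Set.Iio κ.ord)) : Prop :=
  (∀ a : Set.Iio κ.ord, ({a} : Set (Set.Iio κ.ord)) ∉ U) ∧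
    CardinalInterFilter (U : Filter (Set.Iio κ.ord)) (Cardinal.lift.{u + 1} κ)

/-- `κ` is a measurable cardinal: it is uncountable and it carries a non-principal `κ`-complete
ultrafilter. -/
def IsMeasurableCardinal (κ : Cardinal.{u}) : Prop :=
  ℵ₀ < κ ∧ ∃ U : Ultrafilter (Set.Iio κ.ord), IsNonprincipalComplete κ U

/-! ### The language of set theory and its class-sized structures -/

/-- The relation symbols of the language of set theory: one binary symbol. -/
inductive SetRel : ℕ → Type
  | mem : SetRel 2

/-- The first-order language of set theory. -/
def setLanguage : FirstOrder.Language.{0, 0} := ⟨fun _ => Empty, SetRel⟩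

/-- The universe `V` of sets, as a structure for the language of set theory. -/
instance : setLanguage.Structure ZFSet.{u} where
  funMap f := f.elim
  RelMap | .mem => fun v => v 0 ∈ v 1

/-- A class `M` of sets, as a structure `(M, ∈)` for the language of set theory. -/
instance (M : Set ZFSet.{u}) : setLanguage.Structure M where
  funMap f := f.elim
  RelMap | .mem => fun v => (v 0 : ZFSet.{u}) ∈ (v 1 : ZFSet.{u})

/-- The class `M` is transitive. -/
def IsTransitiveClass (M : Set ZFSet.{u}) : Prop :=
  ∀ x ∈ M, ∀ y ∈ x, y ∈ M

/-- The class `M` is closed under `κ`-sequences: every function with domain `κ` all of whose values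
lie in `M` is an element of `M`. -/
def IsClosedUnderSeq (M : Set ZFSet.{u}) (κ : Cardinal.{u}) : Prop :=
  ∀ y f : ZFSet.{u}, (∀ z ∈ y, z ∈ M) → ZFSet.IsFunc κ.ord.toZFSet y f → f ∈ M

/-- The map `j : V → M` is definable: its graph is defined over `(V, ∈)` by a first-order formula
with parameters from `V`. -/
def IsDefinableMap {M : Set ZFSet.{u}} (j : ZFSet.{u} → M) : Prop :=
  (Set.univ : Set ZFSet.{u}).Definable₂ setLanguage {p | (j p.1 : ZFSet.{u}) = p.2}

/-- The critical point of `j : V → M` is `κ`: the initial ordinal of `κ` is the least ordinal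
moved by `j`. -/
def HasCrit {M : Set ZFSet.{u}} (j : ZFSet.{u} → M) (κ : Cardinal.{u}) : Prop :=
  (∀ a < κ.ord, (j a.toZFSet : ZFSet.{u}) = a.toZFSet) ∧
    (j κ.ord.toZFSet : ZFSet.{u}) ≠ κ.ord.toZFSet

/-- A subset `X` of `κ`, as an element of the universe of sets: the set of von Neumann ordinals
`{a | a ∈ X}`. -/
noncomputable def subsetToZFSet {κ : Cardinal.{u}} (X : Set (Set.Iio κ.ord)) : ZFSet.{u} :=
  ZFSet.sep (fun z => ∃ a ∈ X, (a : Ordinal.{u}).toZFSet = z) κ.ord.toZFSet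

/-! ### The gluing property -/

/-- The cardinal `κ` has the `α`-gluing property: for every `α`-sequence `U` of non-principal
`κ`-complete ultrafilters over `κ` there are a definable elementary embedding `j : V → M` into a
transitive class `M` with critical point `κ` and closed under `κ`-sequences, and an increasing
`α`-sequence `η` of ordinals, such that `U β = {X ⊆ κ | η β ∈ j X}` for all `β < α`. -/
def HasGP (κ : Cardinal.{u}) (α : Ordinal.{u}) : Prop :=
  ∀ U : Set.Iio α → Ultrafilter (Set.Iio κ.ord), (∀ β, IsNonprincipalComplete κ (U β)) →
    ∃ (M : Set ZFSet.{u}) (j : ZFSet.{u} ↪ₑ[setLanguage] M),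
      IsTransitiveClass M ∧ IsDefinableMap j ∧ HasCrit j κ ∧ IsClosedUnderSeq M κ ∧
      ∃ η : Set.Iio α → Ordinal.{u}, StrictMono η ∧
        ∀ (β : Set.Iio α) (X : Set (Set.Iio κ.ord)),
          X ∈ U β ↔ (η β).toZFSet ∈ (j (subsetToZFSet X) : ZFSet.{u})

/-- The cardinal `κ` has the `<α`-gluing property: it has the `β`-gluing property for all (infinite)
ordinals `β < α`. -/
def HasGPBelow (κ : Cardinal.{u}) (α : Ordinal.{u}) : Prop :=
  ∀ β : Ordinal.{u}, Ordinal.omega0 ≤ β → β < α → HasGP κ β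

end Gluing

/-! Write `μ` for the larger measurable cardinal. Only lengths `α` with `μ ≤ α < μ⁺` are new, and
such an `α` has cardinality `μ`. Through a bijection with `μ`, `α` is exhausted by infinite sets `d
ξ` (`ξ < μ`) of size less than `μ`, and the hypothesis, applied to the order type of `d ξ`, glues
the ultrafilters indexed by `d ξ`.

These partial embeddings are combined through filters on the set of functions `α → κ`. If `j : V →
M` glues the indices in `d` with seeds `η β`, let `X` belong to `F` when `M` sees the seeds as an
element of `j(X)`. As `M` is closed only under `κ`-sequences, at most `κ` seeds at a time form an
element of `M`. Hence `F` is a `κ`-complete filter deciding the sets that depend on at most `κ`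
coordinates (`exists_isGluingFilter`). Given a `μ`-complete nonprincipal ultrafilter `D` on `μ`, the
limit of the filters `F ξ` along `D` has the same properties and glues all coordinates, since each
`β` lies in `d ξ` for `D`-almost all `ξ` (`hasGPBelow_succ`).

Conversely, a filter gluing all coordinates gives an embedding, namely the ultrapower of `V` by
functions depending on at most `κ` coordinates (`exists_embedding`). Completeness makes it
well-founded with critical point `κ`. Any `κ` such functions have a common support of size `κ`,
which makes the target closed under `κ`-sequences. The seeds are the classes of the coordinate
functions. The embedding is definable because every value of the collapse is witnessed by a
set-sized fragment of it. -/

namespace Gluing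

open FirstOrder Cardinal Set

/-! ### Formulas of set theory with named variables -/

/-- Formulas of set theory with variables named by natural numbers and a bounded quantifier. -/
inductive SetFormula
  | mem (i j : ℕ)
  | eq (i j : ℕ)
  | bot
  | imp (φ ψ : SetFormula)
  | all (i : ℕ) (φ : SetFormula)
  | allIn (i j : ℕ) (φ : SetFormula)

namespace SetFormula

/-- Truth of a formula in the structure `(M, ∈)`. -/
def Eval (M : Set ZFSet.{u}) : SetFormula → (ℕ → ZFSet.{u}) → Prop
  | mem i j, v => v i ∈ v j
  | eq i j, v => v i = v j
  | bot, _ => False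
  | imp φ ψ, v => Eval M φ v → Eval M ψ v
  | all i φ, v => ∀ x ∈ M, Eval M φ (Function.update v i x)
  | allIn i j φ, v =>
    ∀ x ∈ M, x ∈ Function.update v i x j → Eval M φ (Function.update v i x)

/-- All quantifiers of the formula are bounded. -/
def Bounded : SetFormula → Prop
  | mem _ _ => True
  | eq _ _ => True
  | bot => True
  | imp φ ψ => Bounded φ ∧ Bounded ψ
  | all _ _ => False
  | allIn _ _ φ => Bounded φ

/-- Negation. -/
def not (φ : SetFormula) : SetFormula := imp φ bot
/-- Conjunction. -/
def and (φ ψ : SetFormula) : SetFormula := not (imp φ (not ψ))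
/-- Disjunction. -/
def or (φ ψ : SetFormula) : SetFormula := imp (not φ) ψ
/-- Equivalence. -/
def iff (φ ψ : SetFormula) : SetFormula := and (imp φ ψ) (imp ψ φ)
/-- Existential quantification. -/
def ex (i : ℕ) (φ : SetFormula) : SetFormula := not (all i (not φ))
/-- Bounded existential quantification. -/
def exIn (i j : ℕ) (φ : SetFormula) : SetFormula := not (allIn i j (not φ))

section Eval

variable (M : Set ZFSet.{u}) (i j : ℕ) (φ ψ : SetFormula) (v : ℕ → ZFSet.{u})

@[simp] theorem eval_mem : (mem i j).Eval M v ↔ v i ∈ v j := Iff.rfl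
@[simp] theorem eval_eq : (eq i j).Eval M v ↔ v i = v j := Iff.rfl
@[simp] theorem eval_bot : bot.Eval M v ↔ False := Iff.rfl
@[simp] theorem eval_imp : (imp φ ψ).Eval M v ↔ (φ.Eval M v → ψ.Eval M v) := Iff.rfl
@[simp] theorem eval_all :
    (all i φ).Eval M v ↔ ∀ x ∈ M, φ.Eval M (Function.update v i x) := Iff.rfl
@[simp] theorem eval_allIn : (allIn i j φ).Eval M v ↔
    ∀ x ∈ M, x ∈ Function.update v i x j → φ.Eval M (Function.update v i x) := Iff.rfl
@[simp] theorem eval_not : (not φ).Eval M v ↔ ¬ φ.Eval M v := Iff.rfl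
@[simp] theorem eval_and : (and φ ψ).Eval M v ↔ φ.Eval M v ∧ ψ.Eval M v := by
  simp [and]
@[simp] theorem eval_or : (or φ ψ).Eval M v ↔ φ.Eval M v ∨ ψ.Eval M v := by
  simp [or, or_iff_not_imp_left]
@[simp] theorem eval_iff : (iff φ ψ).Eval M v ↔ (φ.Eval M v ↔ ψ.Eval M v) := by
  simp [iff, iff_def]
@[simp] theorem eval_ex :
    (ex i φ).Eval M v ↔ ∃ x ∈ M, φ.Eval M (Function.update v i x) := by
  simp [ex]
@[simp] theorem eval_exIn : (exIn i j φ).Eval M v ↔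
    ∃ x ∈ M, x ∈ Function.update v i x j ∧ φ.Eval M (Function.update v i x) := by
  simp [exIn]

@[simp] theorem bounded_mem : (mem i j).Bounded := trivial
@[simp] theorem bounded_eq : (eq i j).Bounded := trivial
@[simp] theorem bounded_bot : bot.Bounded := trivial
@[simp] theorem bounded_imp : (imp φ ψ).Bounded ↔ φ.Bounded ∧ ψ.Bounded := Iff.rfl
@[simp] theorem bounded_allIn : (allIn i j φ).Bounded ↔ φ.Bounded := Iff.rfl
@[simp] theorem bounded_not : (not φ).Bounded ↔ φ.Bounded := by simp [not]
@[simp] theorem bounded_and : (and φ ψ).Bounded ↔ φ.Bounded ∧ ψ.Bounded := by simp [and]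
@[simp] theorem bounded_or : (or φ ψ).Bounded ↔ φ.Bounded ∧ ψ.Bounded := by simp [or]
@[simp] theorem bounded_iff : (iff φ ψ).Bounded ↔ φ.Bounded ∧ ψ.Bounded := by
  simp [iff]; tauto
@[simp] theorem bounded_exIn : (exIn i j φ).Bounded ↔ φ.Bounded := by simp [exIn]

end Eval

/-- Bounded formulas are absolute for transitive classes. -/
theorem Bounded.eval_iff {M : Set ZFSet.{u}} (hM : IsTransitiveClass M) :
    ∀ {φ : SetFormula}, φ.Bounded → ∀ v : ℕ → ZFSet.{u}, (∀ n, v n ∈ M) →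
      (φ.Eval M v ↔ φ.Eval univ v)
  | mem _ _, _, _, _ => Iff.rfl
  | eq _ _, _, _, _ => Iff.rfl
  | bot, _, _, _ => Iff.rfl
  | imp _ _, h, v, hv => imp_congr (Bounded.eval_iff hM h.1 v hv) (Bounded.eval_iff hM h.2 v hv)
  | allIn i j φ, h, v, hv => by
    have key : ∀ x ∈ M, (φ.Eval M (Function.update v i x) ↔ φ.Eval univ (Function.update v i x)) :=
      fun x hx => Bounded.eval_iff (φ := φ) hM h _ fun n => by
        by_cases hn : n = i
        · subst hn; simpa using hx
        · simpa [hn] using hv n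
    constructor
    · intro H x _ hx
      -- If `j = i`, the guard reads `x ∈ x` and fails by foundation; otherwise `x` is an element of
      -- `v j ∈ M`.
      have hxM : x ∈ M := by
        by_cases hj : j = i
        · subst hj; simp [ZFSet.mem_irrefl] at hx
        · exact hM _ (hv j) _ (by simpa [hj] using hx)
      exact (key x hxM).1 (H x hxM hx)
    · intro H x hxM hx
      exact (key x hxM).2 (H x (mem_univ _) hx)

/-- The formula `v i = {v j, v k}`; `l` is an auxiliary variable. -/
def isUPair (i j k l : ℕ) : SetFormula :=
  and (mem j i) (and (mem k i) (allIn l i (or (eq l j) (eq l k))))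

/-- The formula `v i = (v j, v k)` for the Kuratowski pair; `l` and `l + 1` are auxiliary
variables. -/
def isPair (i j k l : ℕ) : SetFormula :=
  and (exIn l i (isUPair l j j (l + 1)))
    (and (exIn l i (isUPair l j k (l + 1)))
      (allIn l i (or (isUPair l j j (l + 1)) (isUPair l j k (l + 1)))))

theorem bounded_isUPair (i j k l : ℕ) : (isUPair i j k l).Bounded := by simp [isUPair]

@[simp] theorem bounded_isPair (i j k l : ℕ) : (isPair i j k l).Bounded := by
  simp [isPair, bounded_isUPair]

theorem eval_isUPair {i j k l : ℕ} (hi : i ≠ l) (hj : j ≠ l) (hk : k ≠ l) (v : ℕ → ZFSet.{u}) :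
    (isUPair i j k l).Eval univ v ↔ v i = {v j, v k} := by
  simp only [isUPair, eval_and, eval_mem, eval_allIn, mem_univ, eval_or, eval_eq,
    Function.update_self, Function.update_of_ne hi, Function.update_of_ne hj,
    Function.update_of_ne hk, true_imp_iff]
  constructor
  · rintro ⟨h1, h2, h3⟩
    ext z
    rw [ZFSet.mem_pair]
    exact ⟨h3 z, by rintro (rfl | rfl) <;> assumption⟩
  · intro h
    simp [h]

theorem eval_isPair {i j k l : ℕ} (hi : i < l) (hj : j < l) (hk : k < l) (v : ℕ → ZFSet.{u}) :
    (isPair i j k l).Eval univ v ↔ v i = ZFSet.pair (v j) (v k) := by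
  have e : ∀ x m, m < l → Function.update v l x m = v m := fun x m h =>
    Function.update_of_ne h.ne _ _
  have e1 : ∀ x, ∀ m, m < l → ((isUPair l j m (l + 1)).Eval univ (Function.update v l x) ↔
      x = {v j, v m}) := fun x m hm => by
    rw [eval_isUPair (by omega) (by omega) (by omega), Function.update_self, e _ _ hj, e _ _ hm]
  simp only [isPair, eval_and, eval_exIn, eval_allIn, mem_univ, eval_or, e1 _ _ hj, e1 _ _ hk,
    true_and, true_imp_iff, e _ _ hi]
  constructor
  · rintro ⟨⟨_, h1, rfl⟩, ⟨_, h2, rfl⟩, h3⟩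
    ext z
    rw [ZFSet.pair, ZFSet.mem_pair]
    refine ⟨fun hz => by simpa using h3 z hz, ?_⟩
    rintro (rfl | rfl)
    · simpa using h1
    · exact h2
  · intro h
    simp [h, ZFSet.pair]

/-- The membership symbol. -/
def memSymbol : setLanguage.Relations 2 := SetRel.mem

/-- Universal quantification over the variable `i`. -/
noncomputable def allVar (i : ℕ) (φ : setLanguage.Formula ℕ) : setLanguage.Formula ℕ :=
  Language.BoundedFormula.all (n := 0) (Language.BoundedFormula.relabel (n := 1)
    (fun n => if n = i then Sum.inr 0 else Sum.inl n) φ)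

theorem realize_allVar {N : Type*} [setLanguage.Structure N] (i : ℕ) (φ : setLanguage.Formula ℕ)
    (v : ℕ → N) : (allVar i φ).Realize v ↔ ∀ x, φ.Realize (Function.update v i x) := by
  rw [allVar, Language.Formula.Realize, Language.BoundedFormula.realize_all]
  refine forall_congr' fun x => ?_
  rw [Language.BoundedFormula.realize_relabel, Language.Formula.Realize, iff_iff_eq]
  congr 1
  · funext n
    by_cases hn : n = i
    · subst hn
      simp [Fin.snoc]
    · simp [hn]
  · exact Subsingleton.elim _ _

/-- Translation into a formula of the language of set theory. -/
noncomputable def toFormula : SetFormula → setLanguage.Formula ℕ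
  | mem i j => memSymbol.formula₂
      (Language.Term.var i) (Language.Term.var j)
  | eq i j => Language.Term.equal (Language.Term.var i) (Language.Term.var j)
  | bot => ⊥
  | imp φ ψ => φ.toFormula.imp ψ.toFormula
  | all i φ => allVar i φ.toFormula
  | allIn i j φ => allVar i ((memSymbol.formula₂
      (Language.Term.var i) (Language.Term.var j)).imp φ.toFormula)

/-- The injection `ι` treats both structures at once: the identity for `V` and the inclusion for a
class `M`. -/
theorem realize_toFormula {N : Type*} [setLanguage.Structure N] (ι : N → ZFSet.{u})
    (hι : Function.Injective ι)
    (hmem : ∀ v : Fin 2 → N, Language.Structure.RelMap memSymbol v ↔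
      ι (v 0) ∈ ι (v 1)) :
    ∀ (φ : SetFormula) (v : ℕ → N), φ.toFormula.Realize v ↔ φ.Eval (range ι) (ι ∘ v) := by
  have hm : ∀ i j (v : ℕ → N), (memSymbol.formula₂
        (Language.Term.var i) (Language.Term.var j) : setLanguage.Formula ℕ).Realize v ↔
        ι (v i) ∈ ι (v j) := fun i j v => by
    simp [hmem]
  have hu : ∀ (v : ℕ → N) i x, ι ∘ Function.update v i x = Function.update (ι ∘ v) i (ι x) :=
    fun v i x => Function.comp_update ι v i x
  intro φ
  induction φ with
  | mem i j => exact hm i j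
  | eq i j => intro v; simp [toFormula, hι.eq_iff]
  | bot => intro v; simp [toFormula, Language.Formula.Realize]
  | imp φ ψ h1 h2 =>
    intro v
    simp only [toFormula, Language.Formula.realize_imp, h1, h2, eval_imp]
  | all i φ h =>
    intro v
    simp only [toFormula, realize_allVar, h, hu, eval_all, forall_mem_range]
  | allIn i j φ h =>
    intro v
    simp only [toFormula, realize_allVar, Language.Formula.realize_imp, h, hu, eval_allIn, forall_mem_range,
      hm]
    simp only [← hu, Function.comp_apply, Function.update_self]

theorem realize_univ (φ : SetFormula) (v : ℕ → ZFSet.{u}) :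
    φ.toFormula.Realize v ↔ φ.Eval univ v := by
  simpa using realize_toFormula id Function.injective_id (fun _ => Iff.rfl) φ v

theorem realize_class {M : Set ZFSet.{u}} (φ : SetFormula) (v : ℕ → M) :
    φ.toFormula.Realize v ↔ φ.Eval M (fun n => v n) := by
  have := realize_toFormula (Subtype.val : M → ZFSet.{u}) Subtype.val_injective
    (fun _ => Iff.rfl) φ v
  rwa [Subtype.range_coe] at this

/-- Elementarity of `j` for formulas with named variables. -/
theorem eval_elementary {M : Set ZFSet.{u}} (j : ZFSet.{u} ↪ₑ[setLanguage] M) (φ : SetFormula)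
    (v : ℕ → ZFSet.{u}) : φ.Eval univ v ↔ φ.Eval M (fun n => j (v n)) := by
  rw [← realize_univ, ← j.map_formula, realize_class]
  rfl

/-- Elementarity of `j` for bounded formulas, which are absolute for the target. -/
theorem Bounded.transfer {M : Set ZFSet.{u}} (j : ZFSet.{u} ↪ₑ[setLanguage] M)
    (hM : IsTransitiveClass M) {φ : SetFormula} (hφ : φ.Bounded) (v : ℕ → ZFSet.{u}) :
    φ.Eval univ v ↔ φ.Eval univ (fun n => (j (v n) : ZFSet.{u})) := by
  rw [eval_elementary j, hφ.eval_iff hM _ fun n => (j (v n)).2]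

/-- A binary relation defined by a formula with finitely many parameters is definable. -/
theorem definable₂ (φ : SetFormula) (p : ℕ → ZFSet.{u}) (s : Set (ZFSet.{u} × ZFSet.{u}))
    (h : ∀ x y, (x, y) ∈ s ↔ φ.Eval univ
      (fun n => match n with | 0 => x | 1 => y | n + 2 => p n)) :
    (univ : Set ZFSet.{u}).Definable₂ setLanguage s := by
  rw [Set.Definable₂, Set.definable_iff_exists_formula_sum]
  refine ⟨φ.toFormula.relabel (fun n => match n with
    | 0 => Sum.inr 0 | 1 => Sum.inr 1 | n + 2 => Sum.inl ⟨p n, mem_univ _⟩), ?_⟩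
  ext x
  rw [mem_ofPred_eq, mem_ofPred_eq, h, ← realize_univ, Language.Formula.realize_relabel,
    iff_iff_eq]
  congr 1
  funext n
  match n with
  | 0 => rfl
  | 1 => rfl
  | n + 2 => rfl

end SetFormula

/-! ### Ultrapowers by functions of bounded support -/

/-- A `κ`-complete proper filter on `I` which decides every set that is saturated for one of the
equivalence relations in a `κ⁺`-directed family. -/
structure UltraSystem (κ : Cardinal.{u}) (I : Type (u + 1)) where
  /-- the filter -/
  filter : Filter I
  /-- the family of equivalence relations -/
  setoids : Set (Setoid I)
  neBot : filter.NeBot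
  complete : CardinalInterFilter filter (Cardinal.lift.{u + 1} κ)
  aleph0_lt : ℵ₀ < κ
  nonempty : setoids.Nonempty
  directed : ∀ s : Iio κ.ord → Setoid I, (∀ ξ, s ξ ∈ setoids) → ∃ t ∈ setoids, ∀ ξ, t ≤ s ξ
  ultra : ∀ s ∈ setoids, ∀ P : I → Prop, (∀ i i', s i i' → P i = P i') →
    (∀ᶠ i in filter, P i) ∨ ∀ᶠ i in filter, ¬ P i

namespace UltraSystem

variable {κ : Cardinal.{u}} {I : Type (u + 1)} (T : UltraSystem κ I)

instance : T.filter.NeBot := T.neBot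

instance : CardinalInterFilter T.filter (Cardinal.lift.{u + 1} κ) := T.complete

theorem countableInterFilter : CountableInterFilter T.filter :=
  CardinalInterFilter.toCountableInterFilter (c := Cardinal.lift.{u + 1} κ) T.filter
    (by simpa using T.aleph0_lt)

/-- A function is admissible if it is constant on the classes of one of the equivalence
relations. -/
def Adm {β : Type*} (f : I → β) : Prop :=
  ∃ s ∈ T.setoids, ∀ i i', s i i' → f i = f i'

variable {T}

theorem Adm.comp {β γ : Type*} {f : I → β} (hf : T.Adm f) (g : β → γ) :
    T.Adm fun i => g (f i) := by
  obtain ⟨s, hs, h⟩ := hf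
  exact ⟨s, hs, fun i i' hi => congrArg g (h i i' hi)⟩

variable (T) in
theorem adm_const {β : Type*} (b : β) : T.Adm fun _ : I => b :=
  ⟨_, T.nonempty.some_mem, fun _ _ _ => rfl⟩

/-- Directedness supplies one equivalence relation refining those of all `κ` functions. This is the
source of closure under `κ`-sequences. -/
theorem adm_pi {ι β : Type*} (e : Iio κ.ord → ι) (he : Function.Surjective e) {f : ι → I → β}
    (hf : ∀ k, T.Adm (f k)) : T.Adm fun i k => f k i := by
  choose s hs h using hf
  obtain ⟨t, ht, hts⟩ := T.directed (fun ξ => s (e ξ)) fun ξ => hs _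
  refine ⟨t, ht, fun i i' hi => funext fun k => ?_⟩
  obtain ⟨ξ, rfl⟩ := he k
  exact h _ i i' (hts ξ hi)

theorem adm_pi_countable {ι β : Type*} [Countable ι] {f : ι → I → β}
    (hf : ∀ k, T.Adm (f k)) : T.Adm fun i k => f k i := by
  obtain ⟨g, hg⟩ := exists_injective_nat ι
  rcases isEmpty_or_nonempty ι with h | h
  · convert T.adm_const (β := ι → β) (fun k => h.elim k)
  let g' : ι → Iio κ.ord := fun k => ⟨(g k : Ordinal), by
    have h1 : Ordinal.omega0 ≤ κ.ord := by
      rw [← Cardinal.ord_aleph0]; exact Cardinal.ord_le_ord.2 T.aleph0_lt.le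
    exact (Ordinal.natCast_lt_omega0 _).trans_le h1⟩
  have hg' : Function.Injective g' := fun a b hab => hg (by
    have h1 : ((g a : ℕ) : Ordinal.{u}) = (g b : ℕ) := congrArg Subtype.val hab
    exact Nat.cast_injective h1)
  exact adm_pi _ (Function.invFun_surjective hg') hf

theorem Adm.prodMk {β γ : Type*} {f : I → β} {g : I → γ} (hf : T.Adm f) (hg : T.Adm g) :
    T.Adm fun i => (f i, g i) := by
  have : T.Adm fun i (b : Bool) => (if b then Sum.inl (f i) else Sum.inr (g i) : β ⊕ γ) :=
    adm_pi_countable (f := fun (b : Bool) i => (if b then Sum.inl (f i) else Sum.inr (g i) : β ⊕ γ))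
      fun b => by cases b <;> simp [hf.comp, hg.comp]
  obtain ⟨s, hs, h⟩ := this
  refine ⟨s, hs, fun i i' hi => ?_⟩
  have h1 := congrFun (h i i' hi) true
  have h2 := congrFun (h i i' hi) false
  simp at h1 h2
  exact Prod.ext h1 h2

theorem Adm.comp₂ {β γ δ : Type*} {f : I → β} {g : I → γ} (hf : T.Adm f) (hg : T.Adm g)
    (F : β → γ → δ) : T.Adm fun i => F (f i) (g i) :=
  (hf.prodMk hg).comp fun p => F p.1 p.2

theorem Adm.ultra {P : I → Prop} (hP : T.Adm P) :
    (∀ᶠ i in T.filter, P i) ∨ ∀ᶠ i in T.filter, ¬ P i := by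
  obtain ⟨s, hs, h⟩ := hP
  exact T.ultra s hs P h

theorem Adm.eventually_not {P : I → Prop} (hP : T.Adm P) :
    (∀ᶠ i in T.filter, ¬ P i) ↔ ¬ ∀ᶠ i in T.filter, P i := by
  refine ⟨fun h h' => ?_, fun h => hP.ultra.resolve_left h⟩
  obtain ⟨i, hi, hi'⟩ := (h.and h').exists
  exact hi hi'

/-- If every alternative failed, each negation would hold eventually, and `κ`-completeness would
make them all hold at once. -/
theorem exists_eventually {ι : Type (u + 1)} (hι : #ι < Cardinal.lift.{u + 1} κ)
    {P : ι → I → Prop} (hP : ∀ k, T.Adm (P k)) (h : ∀ᶠ i in T.filter, ∃ k, P k i) :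
    ∃ k, ∀ᶠ i in T.filter, P k i := by
  by_contra hn
  have h1 : ∀ᶠ i in T.filter, ∀ k, ¬ P k i :=
    (Filter.eventually_cardinal_forall hι).2 fun k =>
      (hP k).eventually_not.2 fun hk => hn ⟨k, hk⟩
  obtain ⟨i, ⟨k, hk⟩, hi⟩ := (h.and h1).exists
  exact hi k hk

variable (T) in
/-- The admissible functions from `I` to the universe of sets. -/
def Fn : Type (u + 1) := {f : I → ZFSet.{u} // T.Adm f}

instance : CoeFun T.Fn fun _ => I → ZFSet.{u} := ⟨Subtype.val⟩

variable (T) in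
/-- The constant function. -/
def const (x : ZFSet.{u}) : T.Fn := ⟨fun _ => x, T.adm_const x⟩

@[simp] theorem const_apply (x : ZFSet.{u}) (i : I) : T.const x i = x := rfl

/-- Membership in the ultrapower. -/
def E (g f : T.Fn) : Prop := ∀ᶠ i in T.filter, g i ∈ f i

/-- By countable completeness, a descending chain of functions descends pointwise at a single index,
against foundation. -/
theorem wellFounded_E : WellFounded (E (T := T)) := by
  rw [wellFounded_iff_isEmpty_descending_chain]
  refine ⟨fun ⟨f, hf⟩ => ?_⟩
  have := T.countableInterFilter
  have h : ∀ᶠ i in T.filter, ∀ n, f (n + 1) i ∈ f n i := eventually_countable_forall.2 hf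
  obtain ⟨i, hi⟩ := h.exists
  exact (wellFounded_iff_isEmpty_descending_chain.1 ZFSet.mem_wf).elim ⟨fun n => f n i, hi⟩

/-- `g` takes values in those of `f`, up to the value `∅`. -/
def Tight (g f : T.Fn) : Prop := ∀ i, g i ∈ f i ∨ g i = ∅

open Classical in
/-- Modification of `g` to a function which is tight for `f`. -/
noncomputable def tighten (g f : T.Fn) : T.Fn :=
  ⟨fun i => if g i ∈ f i then g i else ∅,
    g.2.comp₂ f.2 fun a b => if a ∈ b then a else ∅⟩

theorem tight_tighten (g f : T.Fn) : Tight (tighten g f) f := fun i => by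
  by_cases h : g i ∈ f i <;> simp [tighten, h]

theorem eventually_tighten {g f : T.Fn} (h : E g f) :
    ∀ᶠ i in T.filter, g i = tighten g f i := by
  filter_upwards [h] with i hi
  simp [tighten, hi]

theorem E_congr {g g' f f' : T.Fn} (hg : ∀ᶠ i in T.filter, g i = g' i)
    (hf : ∀ᶠ i in T.filter, f i = f' i) (h : E g f) : E g' f' := by
  filter_upwards [hg, hf, h] with i h1 h2 h3
  rwa [← h1, ← h2]

theorem eventually_refl (f : T.Fn) : ∀ᶠ i in T.filter, f i = f i :=
  Filter.Eventually.of_forall fun _ => rfl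

theorem eventually_symm {f g : T.Fn} (h : ∀ᶠ i in T.filter, f i = g i) :
    ∀ᶠ i in T.filter, g i = f i := h.mono fun _ => Eq.symm

/-! ### The Mostowski collapse of the ultrapower. -/

variable [Small.{u} I]

theorem small_of_forall_mem (b : I → ZFSet.{u}) : Small.{u} {g : T.Fn // ∀ i, g i ∈ b i} :=
  small_of_injective (β := ∀ i, {x // x ∈ b i}) (f := fun g i => ⟨g.1 i, g.2 i⟩) fun g g' h => by
    apply Subtype.ext
    apply Subtype.ext
    funext i
    exact congrArg Subtype.val (congrFun h i)

/-- The `E`-predecessors of `f` may form a proper class, their values being arbitrary off a set in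
the filter. The tight ones form a set, and each predecessor eventually agrees with a tight one, so
the collapse can recurse over these alone. -/
instance (f : T.Fn) : Small.{u} {g : T.Fn // E g f ∧ Tight g f} := by
  have := small_of_forall_mem (T := T) fun i => insert ∅ (f i)
  refine small_of_injective (β := {g : T.Fn // ∀ i, g i ∈ insert ∅ (f i)})
    (f := fun g => ⟨g.1, fun i => by simpa using (g.2.2 i).symm⟩) fun g g' h => ?_
  exact Subtype.ext (congrArg (fun z => z.1) h)

variable (T) in
/-- The Mostowski collapse of the ultrapower. -/
noncomputable def collapse : T.Fn → ZFSet.{u} :=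
  wellFounded_E.fix fun f ih =>
    ZFSet.range fun g : {g : T.Fn // E g f ∧ Tight g f} => ih g.1 g.2.1

theorem mem_collapse_iff_tight {f : T.Fn} {x : ZFSet.{u}} :
    x ∈ T.collapse f ↔ ∃ g, E g f ∧ Tight g f ∧ T.collapse g = x := by
  rw [collapse, WellFounded.fix_eq, ZFSet.mem_range]
  simp [and_assoc]

theorem collapse_congr (f : T.Fn) :
    ∀ f' : T.Fn, (∀ᶠ i in T.filter, f i = f' i) → T.collapse f = T.collapse f' := by
  induction f using wellFounded_E.induction with
  | _ f ih =>
    intro f' h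
    ext x
    rw [mem_collapse_iff_tight, mem_collapse_iff_tight]
    constructor
    · rintro ⟨g, hg, -, rfl⟩
      have hg' := E_congr (eventually_refl g) h hg
      exact ⟨tighten g f', E_congr (eventually_tighten hg') (eventually_refl f') hg',
        tight_tighten _ _, (ih g hg _ (eventually_tighten hg')).symm⟩
    · rintro ⟨g, hg, -, rfl⟩
      have hg' := E_congr (eventually_refl g) (eventually_symm h) hg
      have hg'' := E_congr (eventually_tighten hg') (eventually_refl f) hg'
      exact ⟨tighten g f, hg'', tight_tighten _ _,
        ih _ hg'' _ (eventually_symm (eventually_tighten hg'))⟩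

theorem mem_collapse_iff {f : T.Fn} {x : ZFSet.{u}} :
    x ∈ T.collapse f ↔ ∃ g, E g f ∧ T.collapse g = x := by
  rw [mem_collapse_iff_tight]
  refine ⟨fun ⟨g, h1, _, h3⟩ => ⟨g, h1, h3⟩, fun ⟨g, h1, h2⟩ => ?_⟩
  refine ⟨tighten g f, E_congr (eventually_tighten h1) (eventually_refl f) h1,
    tight_tighten _ _, ?_⟩
  rw [← h2, ← collapse_congr _ _ (eventually_tighten h1)]

open Classical in
/-- A choice of an element of `a` not in `b`. -/
noncomputable def pickDiff (a b : ZFSet.{u}) : ZFSet.{u} :=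
  if h : ∃ x ∈ a, x ∉ b then h.choose else ∅

theorem pickDiff_spec {a b : ZFSet.{u}} (h : ∃ x ∈ a, x ∉ b) :
    pickDiff a b ∈ a ∧ pickDiff a b ∉ b := by
  rw [pickDiff, dif_pos h]
  exact h.choose_spec

/-- If `f` and `g` differed eventually, a chosen element of one value missing from the other would
be an admissible function. Its collapse lies in both collapses, and the induction hypothesis then
places its values in the wrong set. -/
theorem eventually_eq_of_collapse (f : T.Fn) :
    ∀ g : T.Fn, T.collapse f = T.collapse g → ∀ᶠ i in T.filter, f i = g i := by
  induction f using wellFounded_E.induction with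
  | _ f ih =>
    intro g hfg
    by_contra hne
    have h1 : ∀ᶠ i in T.filter, ¬ (f i = g i) :=
      (f.2.comp₂ g.2 fun a b => a = b).eventually_not.2 hne
    let a : T.Fn := ⟨fun i => pickDiff (f i) (g i), f.2.comp₂ g.2 pickDiff⟩
    let b : T.Fn := ⟨fun i => pickDiff (g i) (f i), f.2.comp₂ g.2 fun x y => pickDiff y x⟩
    rcases (f.2.comp₂ g.2 fun x y => ∃ z ∈ x, z ∉ y).ultra with h2 | h2
    · have ha : E a f := h2.mono fun i hi => (pickDiff_spec hi).1
      have ha' : T.collapse a ∈ T.collapse g := hfg ▸ mem_collapse_iff.2 ⟨a, ha, rfl⟩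
      obtain ⟨k, hk, hka⟩ := mem_collapse_iff.1 ha'
      have hak := ih a ha k hka.symm
      obtain ⟨i, hi1, hi2, hi3⟩ := (hak.and (hk.and h2)).exists
      exact (pickDiff_spec hi3).2 (by rw [← hi1] at hi2; exact hi2)
    · have h3 : ∀ᶠ i in T.filter, ∃ z ∈ g i, z ∉ f i := by
        filter_upwards [h1, h2] with i hi1 hi2
        by_contra! hi3
        push Not at hi2
        exact hi1 (ZFSet.ext fun z => ⟨hi2 z, hi3 z⟩)
      have hb : E b g := h3.mono fun i hi => (pickDiff_spec hi).1
      have hb' : T.collapse b ∈ T.collapse f := hfg ▸ mem_collapse_iff.2 ⟨b, hb, rfl⟩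
      obtain ⟨k, hk, hkb⟩ := mem_collapse_iff.1 hb'
      have hkb' := ih k hk b hkb
      obtain ⟨i, hi1, hi2, hi3⟩ := (hkb'.and (hk.and h3)).exists
      exact (pickDiff_spec hi3).2 (by rw [hi1] at hi2; exact hi2)

theorem collapse_eq_iff {f g : T.Fn} :
    T.collapse f = T.collapse g ↔ ∀ᶠ i in T.filter, f i = g i :=
  ⟨eventually_eq_of_collapse f g, collapse_congr f g⟩

theorem collapse_mem_iff {f g : T.Fn} : T.collapse g ∈ T.collapse f ↔ E g f := by
  rw [mem_collapse_iff]
  refine ⟨fun ⟨h, h1, h2⟩ => ?_, fun h => ⟨g, h, rfl⟩⟩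
  exact E_congr (collapse_eq_iff.1 h2) (eventually_refl f) h1

/-! ### Łoś's theorem and the elementary embedding -/

variable (T) in
/-- The transitive collapse of the ultrapower. -/
def target : Set ZFSet.{u} := range T.collapse

theorem isTransitive_target : IsTransitiveClass T.target := by
  rintro _ ⟨f, rfl⟩ y hy
  obtain ⟨g, -, rfl⟩ := mem_collapse_iff.1 hy
  exact ⟨g, rfl⟩

variable (T) in
/-- The collapse, as a map to the target class. -/
noncomputable def toTarget (f : T.Fn) : T.target := ⟨T.collapse f, f, rfl⟩

theorem toTarget_eq_iff {f g : T.Fn} :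
    T.toTarget f = T.toTarget g ↔ ∀ᶠ i in T.filter, f i = g i := by
  rw [Subtype.ext_iff]
  exact collapse_eq_iff

theorem term_eq_var {α : Type*} (t : setLanguage.Term α) : ∃ a, t = Language.Term.var a := by
  cases t with
  | var a => exact ⟨a, rfl⟩
  | func f => exact f.elim

theorem los {m n : ℕ} (φ : setLanguage.BoundedFormula (Fin m) n) (v : Fin m → T.Fn)
    (xs : Fin n → T.Fn) :
    φ.Realize (fun k => T.toTarget (v k)) (fun k => T.toTarget (xs k)) ↔
      ∀ᶠ i in T.filter, φ.Realize (fun k => v k i) (fun k => xs k i) := by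
  induction φ with
  | falsum => simp [Language.BoundedFormula.Realize, T.neBot.ne]
  | equal t₁ t₂ =>
    obtain ⟨a, rfl⟩ := term_eq_var t₁
    obtain ⟨b, rfl⟩ := term_eq_var t₂
    rcases a with a | a <;> rcases b with b | b <;>
      simp [Language.BoundedFormula.Realize, toTarget_eq_iff]
  | rel R ts =>
    cases R
    obtain ⟨a, ha⟩ := term_eq_var (ts 0)
    obtain ⟨b, hb⟩ := term_eq_var (ts 1)
    have h1 : ∀ w : Fin 2 → T.target, Language.Structure.RelMap (L := setLanguage)
      (SetRel.mem) w ↔ (w 0 : ZFSet.{u}) ∈ (w 1 : ZFSet.{u}) := fun _ => Iff.rfl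
    have h2 : ∀ w : Fin 2 → ZFSet.{u}, Language.Structure.RelMap (L := setLanguage)
      (SetRel.mem) w ↔ w 0 ∈ w 1 := fun _ => Iff.rfl
    simp only [Language.BoundedFormula.Realize, h1, h2, ha, hb, Language.Term.realize_var]
    rcases a with a | a <;> rcases b with b | b <;>
      simp [toTarget, collapse_mem_iff, E]
  | imp φ ψ h1 h2 =>
    simp only [Language.BoundedFormula.realize_imp, h1, h2]
    have hA : T.Adm fun i => φ.Realize (fun k => v k i) (fun k => xs k i) :=
      (adm_pi_countable fun k => (v k).2).comp₂ (adm_pi_countable fun k => (xs k).2)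
        fun a b => φ.Realize a b
    constructor
    · intro h
      rcases hA.ultra with h3 | h3
      · exact (h h3).mono fun _ hi _ => hi
      · exact h3.mono fun _ hi hi' => (hi hi').elim
    · intro h h'
      exact h.mp (h'.mono fun _ a b => b a)
  | all φ ih =>
    have hs : ∀ (h : T.Fn) i, (fun k => (Fin.snoc (α := fun _ => T.Fn) xs h k : T.Fn) i) =
        Fin.snoc (α := fun _ => ZFSet.{u}) (fun k => xs k i) (h i) := fun h i => by
      funext k
      refine Fin.lastCases ?_ (fun k => ?_) k <;> simp
    have hs' : ∀ h : T.Fn, (fun k => T.toTarget (Fin.snoc (α := fun _ => T.Fn) xs h k)) =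
        Fin.snoc (α := fun _ => T.target) (fun k => T.toTarget (xs k)) (T.toTarget h) :=
          fun h => by
      funext k
      refine Fin.lastCases ?_ (fun k => ?_) k <;> simp
    have key : ∀ h : T.Fn, φ.Realize (fun k => T.toTarget (v k))
        (Fin.snoc (α := fun _ => T.target) (fun k => T.toTarget (xs k)) (T.toTarget h)) ↔
        ∀ᶠ i in T.filter, φ.Realize (fun k => v k i)
          (Fin.snoc (α := fun _ => ZFSet.{u}) (fun k => xs k i) (h i)) := fun h => by
      rw [← hs', ih (Fin.snoc (α := fun _ => T.Fn) xs h)]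
      exact iff_of_eq (congrArg (fun P => ∀ᶠ i in T.filter, P i) (funext fun i => by rw [hs]))
    simp only [Language.BoundedFormula.realize_all]
    constructor
    · intro H
      classical
      -- The counterexample is chosen from the values of the parameters alone, so it is constant
      -- wherever they are, and hence admissible.
      let pick : (Fin m → ZFSet.{u}) → (Fin _ → ZFSet.{u}) → ZFSet.{u} := fun a b =>
        if h : ∃ x, ¬ φ.Realize a (Fin.snoc (α := fun _ => ZFSet.{u}) b x) then h.choose else ∅
      have hpick : ∀ a b, (∃ x, ¬ φ.Realize a (Fin.snoc (α := fun _ => ZFSet.{u}) b x)) →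
          ¬ φ.Realize a (Fin.snoc (α := fun _ => ZFSet.{u}) b (pick a b)) := fun a b h => by
        simp only [pick, dif_pos h]
        exact h.choose_spec
      let h : T.Fn := ⟨fun i => pick (fun k => v k i) (fun k => xs k i),
        (adm_pi_countable fun k => (v k).2).comp₂ (adm_pi_countable fun k => (xs k).2) pick⟩
      refine ((key h).1 (H _)).mono fun i hi => ?_
      by_contra! hn
      exact hpick _ _ hn hi
    · rintro H ⟨_, h, rfl⟩
      exact (key h).2 (H.mono fun i hi => hi _)

variable (T) in
/-- The canonical elementary embedding. -/
noncomputable def embedding : ZFSet.{u} ↪ₑ[setLanguage] T.target where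
  toFun x := T.toTarget (T.const x)
  map_formula' := by
    intro n φ x
    have := los (T := T) φ (fun k => T.const (x k)) (fun k => k.elim0)
    rw [Language.Formula.Realize, Language.Formula.Realize]
    refine (Iff.trans (iff_of_eq ?_) this).trans ?_
    · exact congrArg _ (Subsingleton.elim _ _)
    · have h : ∀ P : Prop, (∀ᶠ _ in T.filter, P) ↔ P := fun P => Filter.eventually_const
      refine Iff.trans ?_ (h _)
      refine Filter.eventually_congr (Filter.Eventually.of_forall fun i => iff_of_eq ?_)
      exact congrArg (Language.BoundedFormula.Realize φ x) (Subsingleton.elim _ _)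

@[simp] theorem coe_embedding (x : ZFSet.{u}) :
    (T.embedding x : ZFSet.{u}) = T.collapse (T.const x) := rfl

end UltraSystem

namespace UltraSystem

variable {κ : Cardinal.{u}} {I : Type (u + 1)} {T : UltraSystem κ I}

/-! ### Critical point and closure of the target -/

theorem mk_Iio_lt {a : Ordinal.{u}} (ha : a < κ.ord) :
    #(Iio a) < Cardinal.lift.{u + 1} κ := by
  rw [Cardinal.mk_Iio_ordinal, Cardinal.lift_lt]
  exact Cardinal.lt_ord.1 ha

theorem eventually_eq_const {a : Ordinal.{u}} (ha : a < κ.ord) {g : T.Fn}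
    (hg : ∀ᶠ i in T.filter, g i ∈ a.toZFSet) :
    ∃ b < a, ∀ᶠ i in T.filter, g i = b.toZFSet := by
  obtain ⟨⟨b, hb⟩, h⟩ := exists_eventually (T := T) (mk_Iio_lt ha)
    (P := fun b i => g i = (b : Ordinal.{u}).toZFSet)
    (fun b => g.2.comp fun x => x = (b : Ordinal.{u}).toZFSet)
    (hg.mono fun i hi => by
      obtain ⟨b, hb, h⟩ := Ordinal.mem_toZFSet_iff.1 hi
      exact ⟨⟨b, hb⟩, h.symm⟩)
  exact ⟨b, hb, h⟩

variable [Small.{u} I]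

theorem isOrdinal_collapse (f : T.Fn) :
    (∀ᶠ i in T.filter, (f i).IsOrdinal) → (T.collapse f).IsOrdinal := by
  induction f using wellFounded_E.induction with
  | _ f ih =>
    intro hf
    rw [ZFSet.isOrdinal_iff_forall_mem_isOrdinal]
    constructor
    · intro y hy z hz
      obtain ⟨g, hg, rfl⟩ := mem_collapse_iff.1 hy
      obtain ⟨h, hh, rfl⟩ := mem_collapse_iff.1 hz
      refine collapse_mem_iff.2 ?_
      filter_upwards [hf, hg, hh] with i h1 h2 h3
      exact h1.mem_trans h3 h2
    · intro y hy
      obtain ⟨g, hg, rfl⟩ := mem_collapse_iff.1 hy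
      refine ih g hg ?_
      filter_upwards [hf, hg] with i h1 h2
      exact h1.mem h2

/-- By `κ`-completeness, a function with values in an ordinal `a < κ` is eventually constant, so no
new elements appear below `κ`. -/
theorem collapse_const_of_lt (a : Ordinal.{u}) (ha : a < κ.ord) :
    T.collapse (T.const a.toZFSet) = a.toZFSet := by
  induction a using WellFoundedLT.induction with
  | _ a ih =>
    ext x
    rw [mem_collapse_iff, Ordinal.mem_toZFSet_iff]
    constructor
    · rintro ⟨g, hg, rfl⟩
      obtain ⟨b, hb, h⟩ := eventually_eq_const ha hg
      refine ⟨b, hb, ?_⟩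
      rw [← ih b hb (hb.trans ha)]
      exact collapse_congr _ _ (eventually_symm (g := T.const b.toZFSet) h)
    · rintro ⟨b, hb, rfl⟩
      refine ⟨T.const b.toZFSet, ?_, ih b hb (hb.trans ha)⟩
      exact Filter.Eventually.of_forall fun _ => Ordinal.toZFSet_mem_toZFSet_iff.2 hb

variable (T) in
/-- The filter concentrates on no bounded part of some admissible function into `κ`. -/
def Moves : Prop := ∃ k : T.Fn, (∀ i, k i ∈ κ.ord.toZFSet) ∧
  ∀ a < κ.ord, ¬ ∀ᶠ i in T.filter, k i = a.toZFSet

theorem hasCrit (hT : T.Moves) : HasCrit T.embedding κ := by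
  refine ⟨collapse_const_of_lt, fun h => ?_⟩
  obtain ⟨k, hk, hk'⟩ := hT
  have h1 : T.collapse k ∈ T.collapse (T.const κ.ord.toZFSet) :=
    collapse_mem_iff.2 (Filter.Eventually.of_forall hk)
  rw [coe_embedding] at h
  rw [h] at h1
  obtain ⟨a, ha, h2⟩ := Ordinal.mem_toZFSet_iff.1 h1
  rw [← collapse_const_of_lt (T := T) a ha, collapse_eq_iff] at h2
  exact hk' a ha (h2.mono fun _ h => h.symm)

/-- Since `κ ⊆ j(κ)` and `j(κ) ≠ κ`, the ordinal `κ` belongs to `j(κ)` and so to the transitive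
target. -/
theorem exists_collapse_eq_crit (hT : T.Moves) :
    ∃ k : T.Fn, T.collapse k = κ.ord.toZFSet := by
  obtain ⟨hlt, hne⟩ := hasCrit hT
  have ho : (T.collapse (T.const κ.ord.toZFSet)).IsOrdinal :=
    isOrdinal_collapse _ (Filter.Eventually.of_forall fun _ => ZFSet.isOrdinal_toZFSet _)
  have hsub : κ.ord.toZFSet ⊆ T.collapse (T.const κ.ord.toZFSet) := by
    intro x hx
    obtain ⟨a, ha, rfl⟩ := Ordinal.mem_toZFSet_iff.1 hx
    rw [← collapse_const_of_lt (T := T) a ha]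
    exact collapse_mem_iff.2 (Filter.Eventually.of_forall fun _ => hx)
  rcases ((ZFSet.isOrdinal_toZFSet _).subset_iff_eq_or_mem ho).1 hsub with h | h
  · exact (hne h.symm).elim
  · obtain ⟨k, -, hk⟩ := mem_collapse_iff.1 h
    exact ⟨k, hk⟩

/-- The function `i ↦ {f i, g i}`. -/
def upair (f g : T.Fn) : T.Fn := ⟨fun i => ({f i, g i} : ZFSet.{u}), f.2.comp₂ g.2 fun a b => ({a, b} : ZFSet.{u})⟩

theorem collapse_upair (f g : T.Fn) :
    T.collapse (upair f g) = {T.collapse f, T.collapse g} := by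
  ext x
  rw [mem_collapse_iff, ZFSet.mem_pair]
  constructor
  · rintro ⟨h, hh, rfl⟩
    rw [collapse_eq_iff, collapse_eq_iff]
    have h1 : ∀ᶠ i in T.filter, h i = f i ∨ h i = g i := hh.mono fun i hi => by
      simpa [upair] using hi
    rcases (h.2.comp₂ f.2 fun a b => a = b).ultra with h2 | h2
    · exact Or.inl h2
    · exact Or.inr (h1.mp (h2.mono fun i a b => b.resolve_left a))
  · rintro (rfl | rfl)
    · exact ⟨f, Filter.Eventually.of_forall fun i => by simp [upair], rfl⟩
    · exact ⟨g, Filter.Eventually.of_forall fun i => by simp [upair], rfl⟩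

/-- The function `i ↦ (f i, g i)`. -/
def pairFn (f g : T.Fn) : T.Fn :=
  ⟨fun i => ZFSet.pair (f i) (g i), f.2.comp₂ g.2 ZFSet.pair⟩

theorem collapse_pairFn (f g : T.Fn) :
    T.collapse (pairFn f g) = ZFSet.pair (T.collapse f) (T.collapse g) := by
  have h1 : pairFn f g = upair (upair f f) (upair f g) := by
    apply Subtype.ext
    funext i
    simp [pairFn, upair, ZFSet.pair]
  rw [h1, collapse_upair, collapse_upair, collapse_upair]
  simp [ZFSet.pair]

/-- If `k` represents `κ` and `g ξ` represents the value at `ξ`, the sequence is represented by `H i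
= {(ξ, g ξ i) | ξ ∈ k i}`. It is admissible because `κ` admissible functions can be bundled into
one. -/
theorem isClosedUnderSeq_target (hT : T.Moves) : IsClosedUnderSeq T.target κ := by
  intro y f hy hf
  obtain ⟨k, hk⟩ := exists_collapse_eq_crit hT
  have hval : ∀ ξ : Iio κ.ord, ∃ g : T.Fn, ZFSet.pair (ξ : Ordinal.{u}).toZFSet (T.collapse g) ∈ f ∧
      ∀ w, ZFSet.pair (ξ : Ordinal.{u}).toZFSet w ∈ f → w = T.collapse g := by
    intro ξ
    obtain ⟨w, hw, hw'⟩ := hf.2 _ (Ordinal.toZFSet_mem_toZFSet_iff.2 ξ.2)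
    obtain ⟨g, rfl⟩ := hy w (ZFSet.pair_mem_prod.1 (hf.1 hw)).2
    exact ⟨g, hw, hw'⟩
  choose g hg hg' using hval
  obtain ⟨F, hF⟩ : ∃ F : ZFSet.{u} → (Iio κ.ord → ZFSet.{u}) → ZFSet.{u}, ∀ {a b x},
      x ∈ F a b ↔ ∃ ξ : Iio κ.ord, (ξ : Ordinal.{u}).toZFSet ∈ a ∧
        ZFSet.pair (ξ : Ordinal.{u}).toZFSet (b ξ) = x :=
    ⟨fun a b => ZFSet.range fun ξ : {ξ : Iio κ.ord // (ξ : Ordinal.{u}).toZFSet ∈ a} =>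
      ZFSet.pair (ξ.1 : Ordinal.{u}).toZFSet (b ξ), by simp⟩
  have hg2 : T.Adm fun i ξ => g ξ i := adm_pi id Function.surjective_id fun ξ => (g ξ).2
  obtain ⟨H, hH⟩ : ∃ H : T.Fn, ∀ i, H i = F (k i) fun ξ => g ξ i :=
    ⟨⟨fun i => F (k i) fun ξ => g ξ i, k.2.comp₂ hg2 F⟩, fun _ => rfl⟩
  have key : ∀ ξ : Iio κ.ord, T.collapse (pairFn (T.const (ξ : Ordinal.{u}).toZFSet) (g ξ)) =
      ZFSet.pair (ξ : Ordinal.{u}).toZFSet (T.collapse (g ξ)) := fun ξ => by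
    rw [collapse_pairFn, collapse_const_of_lt _ ξ.2]
  refine ⟨H, ?_⟩
  ext x
  rw [mem_collapse_iff]
  constructor
  · rintro ⟨r, hr, rfl⟩
    have hr' : ∀ᶠ i in T.filter, ∃ ξ : Iio κ.ord, (ξ : Ordinal.{u}).toZFSet ∈ k i ∧
        ZFSet.pair (ξ : Ordinal.{u}).toZFSet (g ξ i) = r i := hr.mono fun i hi => hF.1 (by rwa [← hH])
    classical
    let fst : ZFSet.{u} → ZFSet.{u} := fun p => if h : ∃ a b, p = ZFSet.pair a b then h.choose else ∅
    have hfst : ∀ a b, fst (ZFSet.pair a b) = a := fun a b => by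
      have h : ∃ a' b', ZFSet.pair a b = ZFSet.pair a' b' := ⟨a, b, rfl⟩
      simp only [fst, dif_pos h]
      obtain ⟨b', h'⟩ := h.choose_spec
      exact (ZFSet.pair_inj.1 h').1.symm
    let q : T.Fn := ⟨fun i => fst (r i), r.2.comp fst⟩
    -- The first coordinate of `r` represents an element of `κ`, hence is eventually a fixed `a`;
    -- this identifies `r` with the pair at `a`.
    have hq : E q k := hr'.mono fun i ⟨ξ, h1, h2⟩ => by
      change fst (r i) ∈ k i
      rw [← h2, hfst]
      exact h1
    have hq' := collapse_mem_iff.2 hq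
    rw [hk] at hq'
    obtain ⟨a, ha, h⟩ := Ordinal.mem_toZFSet_iff.1 hq'
    rw [← collapse_const_of_lt (T := T) a ha, collapse_eq_iff] at h
    have h3 : T.collapse r = T.collapse (pairFn (T.const a.toZFSet) (g ⟨a, ha⟩)) := by
      rw [collapse_eq_iff]
      filter_upwards [h, hr'] with i h1 ⟨ξ, h2, h3⟩
      change a.toZFSet = fst (r i) at h1
      rw [← h3, hfst] at h1
      have h4 : ξ = ⟨a, ha⟩ := Subtype.ext (Ordinal.toZFSet_injective h1.symm)
      subst h4
      exact h3.symm
    rw [h3, key ⟨a, ha⟩]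
    exact hg _
  · intro hx
    obtain ⟨z, hz, w, hw, rfl⟩ := ZFSet.mem_prod.1 (hf.1 hx)
    obtain ⟨a, ha, rfl⟩ := Ordinal.mem_toZFSet_iff.1 hz
    have := hg' ⟨a, ha⟩ w hx
    subst this
    have h1 : E (T.const a.toZFSet) k := collapse_mem_iff.1 (by
      rw [hk, collapse_const_of_lt a ha]; exact hz)
    have h2 : E (pairFn (T.const a.toZFSet) (g ⟨a, ha⟩)) H := h1.mono fun i hi => by
      rw [hH]
      exact hF.2 ⟨⟨a, ha⟩, hi, rfl⟩
    exact ⟨_, h2, key ⟨a, ha⟩⟩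

end UltraSystem

/-! ### Definability of the ultrapower embedding -/

namespace SetFormula

/-- The formula `(v a, v b) ∈ v k`; `l`, `l + 1` and `l + 2` are auxiliary variables. -/
def pairMem (a b k l : ℕ) : SetFormula := exIn l k (isPair l a b (l + 1))

@[simp] theorem bounded_pairMem (a b k l : ℕ) : (pairMem a b k l).Bounded := by
  simp [pairMem]

theorem eval_pairMem {a b k l : ℕ} (ha : a < l) (hb : b < l) (hk : k < l) (v : ℕ → ZFSet.{u}) :
    (pairMem a b k l).Eval univ v ↔ ZFSet.pair (v a) (v b) ∈ v k := by
  simp only [pairMem, eval_exIn, mem_univ, true_and,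
    eval_isPair (show l < l + 1 by omega) (show a < l + 1 by omega) (show b < l + 1 by omega),
    Function.update_self, Function.update_of_ne ha.ne, Function.update_of_ne hb.ne,
    Function.update_of_ne hk.ne]
  exact ⟨fun ⟨x, h1, h2⟩ => h2 ▸ h1, fun h => ⟨_, h, rfl⟩⟩

end SetFormula

/-- Codes of admissible functions: `f` is a function on `A` which is constant on the classes of
one of the relations in `S`. -/
def IsAdmCode (A S f : ZFSet.{u}) : Prop :=
  (∀ p ∈ f, ∃ i ∈ A, ∃ x, p = ZFSet.pair i x) ∧ (∀ i ∈ A, ∃ x, ZFSet.pair i x ∈ f) ∧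
    ∃ s ∈ S, ∀ i ∈ A, ∀ i' ∈ A, ZFSet.pair i i' ∈ s →
      ∀ x x', ZFSet.pair i x ∈ f → ZFSet.pair i' x' ∈ f → x = x'

/-- Membership in the ultrapower, for codes of functions. -/
def CodeE (W g f : ZFSet.{u}) : Prop :=
  ∃ X ∈ W, ∀ i ∈ X, ∃ x y, ZFSet.pair i x ∈ g ∧ ZFSet.pair i y ∈ f ∧ x ∈ y

/-- The values of `g` belong to those of `f` or are empty. -/
def CodeTight (A g f : ZFSet.{u}) : Prop :=
  ∀ i ∈ A, ∀ x, ZFSet.pair i x ∈ g → x = ∅ ∨ ∃ y, ZFSet.pair i y ∈ f ∧ x ∈ y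

/-- `G` is a fragment of the collapse, closed downwards. -/
def IsCollapseFragment (A S W G : ZFSet.{u}) : Prop :=
  ∀ f z, ZFSet.pair f z ∈ G → IsAdmCode A S f ∧
    (∀ w, w ∈ z ↔ ∃ g, ZFSet.pair g w ∈ G ∧ CodeE W g f) ∧
    ∀ g, IsAdmCode A S g → CodeTight A g f → CodeE W g f → ∃ w, ZFSet.pair g w ∈ G

/-- The graph of the ultrapower embedding. -/
def IsEmbeddingGraph (A S W x y : ZFSet.{u}) : Prop :=
  ∃ G, IsCollapseFragment A S W G ∧ ∃ f, ZFSet.pair f y ∈ G ∧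
    ∀ i ∈ A, ∀ z, ZFSet.pair i z ∈ f → z = x

/-! ### Formulas defining the collapse and its embedding. -/

namespace SetFormula

/-- `IsAdmCode (v 2) (v 3) (v a)`. -/
def admCode (a : ℕ) : SetFormula :=
  and (allIn 10 a (exIn 11 2 (ex 12 (isPair 10 11 12 20))))
    (and (allIn 10 2 (ex 11 (pairMem 10 11 a 20)))
      (exIn 10 3 (allIn 11 2 (allIn 12 2 (imp (pairMem 11 12 10 20)
        (all 13 (all 14 (imp (pairMem 11 13 a 20) (imp (pairMem 12 14 a 20) (eq 13 14))))))))))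

/-- `CodeE (v 4) (v a) (v b)`. -/
def codeE (a b : ℕ) : SetFormula :=
  exIn 10 4 (allIn 11 10 (ex 12 (ex 13 (and (pairMem 11 12 a 20)
    (and (pairMem 11 13 b 20) (mem 12 13))))))

/-- `CodeTight (v 2) (v a) (v b)`. -/
def codeTight (a b : ℕ) : SetFormula :=
  allIn 10 2 (all 11 (imp (pairMem 10 11 a 20)
    (or (allIn 12 11 bot) (ex 12 (and (pairMem 10 12 b 20) (mem 11 12))))))

/-- `IsCollapseFragment (v 2) (v 3) (v 4) (v 5)`. -/
def collapseFragment : SetFormula :=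
  all 6 (all 7 (imp (pairMem 6 7 5 20) (and (admCode 6)
    (and (all 8 (iff (mem 8 7) (ex 9 (and (pairMem 9 8 5 20) (codeE 9 6)))))
      (all 9 (imp (admCode 9) (imp (codeTight 9 6) (imp (codeE 9 6)
        (ex 8 (pairMem 9 8 5 20))))))))))

/-- `IsEmbeddingGraph (v 2) (v 3) (v 4) (v 0) (v 1)`. -/
def embeddingGraph : SetFormula :=
  ex 5 (and collapseFragment (ex 6 (and (pairMem 6 1 5 20)
    (allIn 7 2 (all 8 (imp (pairMem 7 8 6 20) (eq 8 0)))))))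

/-- The bound `a < 10` keeps the argument from being captured: the bound variables start at 10, and
those of `pairMem` and `isPair` at 20. -/
theorem eval_admCode {a : ℕ} (h : a < 10) (v : ℕ → ZFSet.{u}) :
    (admCode a).Eval univ v ↔ IsAdmCode (v 2) (v 3) (v a) := by
  have h1 : a < 20 := by omega
  have h0 := h.ne
  simp [admCode, IsAdmCode, eval_pairMem, eval_isPair, h1, h0,
    (show a ≠ 11 by omega), (show a ≠ 12 by omega), (show a ≠ 13 by omega),
    (show a ≠ 14 by omega)]

theorem eval_codeE {a b : ℕ} (ha : a < 10) (hb : b < 10) (v : ℕ → ZFSet.{u}) :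
    (codeE a b).Eval univ v ↔ CodeE (v 4) (v a) (v b) := by
  simp [codeE, CodeE, eval_pairMem, (show a < 20 by omega),
    (show b < 20 by omega), (show a ≠ 10 by omega), (show a ≠ 11 by omega),
    (show a ≠ 12 by omega), (show a ≠ 13 by omega), (show b ≠ 10 by omega),
    (show b ≠ 11 by omega), (show b ≠ 12 by omega), (show b ≠ 13 by omega)]

theorem eval_codeTight {a b : ℕ} (ha : a < 10) (hb : b < 10) (v : ℕ → ZFSet.{u}) :
    (codeTight a b).Eval univ v ↔ CodeTight (v 2) (v a) (v b) := by
  simp [codeTight, CodeTight, eval_pairMem, (show a < 20 by omega),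
    (show b < 20 by omega), (show a ≠ 10 by omega), (show a ≠ 11 by omega),
    (show b ≠ 10 by omega), (show b ≠ 11 by omega), (show b ≠ 12 by omega),
    ZFSet.eq_empty]

theorem eval_collapseFragment (v : ℕ → ZFSet.{u}) :
    collapseFragment.Eval univ v ↔ IsCollapseFragment (v 2) (v 3) (v 4) (v 5) := by
  simp [collapseFragment, IsCollapseFragment, eval_pairMem, eval_admCode,
    eval_codeE, eval_codeTight]

theorem eval_embeddingGraph (v : ℕ → ZFSet.{u}) :
    embeddingGraph.Eval univ v ↔ IsEmbeddingGraph (v 2) (v 3) (v 4) (v 0) (v 1) := by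
  simp [embeddingGraph, IsEmbeddingGraph, eval_pairMem,
    eval_collapseFragment]

end SetFormula

/-! ### Coding the ultrapower by sets. -/

namespace UltraSystem

variable {κ : Cardinal.{u}} {I : Type (u + 1)} (T : UltraSystem κ I) [Small.{u} I]
  (c : I → ZFSet.{u})

/-- The code of an admissible function. -/
noncomputable def code (f : T.Fn) : ZFSet.{u} := ZFSet.range fun i => ZFSet.pair (c i) (f i)

/-- The set of codes of the indices. -/
noncomputable def codeIndex : ZFSet.{u} := ZFSet.range c

instance small_setoid : Small.{u} (Setoid I) :=
  small_of_injective (β := I → I → Prop) (f := fun s => s.r) fun _ _ h =>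
    Setoid.ext fun a b => iff_of_eq (congrFun (congrFun h a) b)

/-- The set of codes of the equivalence relations. -/
noncomputable def codeSetoids : ZFSet.{u} :=
  ZFSet.range fun s : T.setoids =>
    ZFSet.range fun p : {p : I × I // s.1 p.1 p.2} => ZFSet.pair (c p.1.1) (c p.1.2)

/-- The set of codes of the sets in the filter. -/
noncomputable def codeFilter : ZFSet.{u} :=
  ZFSet.range fun X : {X : Set I // X ∈ T.filter} => ZFSet.range fun i : X.1 => c i

variable {T c}

theorem pair_mem_code (hc : Function.Injective c) {f : T.Fn} {i : I} {x : ZFSet.{u}} :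
    ZFSet.pair (c i) x ∈ T.code c f ↔ x = f i := by
  simp only [code, ZFSet.mem_range, ZFSet.pair_inj]
  refine ⟨?_, fun h => ⟨i, rfl, h.symm⟩⟩
  rintro ⟨i', h1, rfl⟩
  rw [hc h1]

theorem isAdmCode_iff (hc : Function.Injective c) {F : ZFSet.{u}} :
    IsAdmCode (codeIndex c) (T.codeSetoids c) F ↔ ∃ f : T.Fn, F = T.code c f := by
  constructor
  · rintro ⟨h1, h2, s, hs, h3⟩
    simp only [codeSetoids, ZFSet.mem_range] at hs
    obtain ⟨⟨s, hsT⟩, rfl⟩ := hs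
    have hmem : ∀ i, c i ∈ codeIndex c := fun i => ZFSet.mem_range_self i
    choose f hf using fun i => h2 (c i) (hmem i)
    have h4 : ∀ i i', s i i' → ∀ x x', ZFSet.pair (c i) x ∈ F → ZFSet.pair (c i') x' ∈ F → x = x' :=
      fun i i' hi => h3 _ (hmem i) _ (hmem i')
        (by rw [ZFSet.mem_range]; exact ⟨⟨(i, i'), hi⟩, rfl⟩)
    refine ⟨⟨f, s, hsT, fun i i' hi => h4 i i' hi _ _ (hf i) (hf i')⟩, ?_⟩
    ext p
    simp only [code, ZFSet.mem_range]
    constructor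
    · intro hp
      obtain ⟨i, hi, x, rfl⟩ := h1 p hp
      obtain ⟨i, rfl⟩ := ZFSet.mem_range.1 hi
      exact ⟨i, by rw [h4 i i (s.refl i) _ _ (hf i) hp]⟩
    · rintro ⟨i, rfl⟩
      exact hf i
  · rintro ⟨f, rfl⟩
    refine ⟨?_, ?_, ?_⟩
    · intro p hp
      obtain ⟨i, rfl⟩ := ZFSet.mem_range.1 hp
      exact ⟨c i, ZFSet.mem_range_self i, f i, rfl⟩
    · intro i hi
      obtain ⟨i, rfl⟩ := ZFSet.mem_range.1 hi
      exact ⟨f i, (pair_mem_code hc).2 rfl⟩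
    · obtain ⟨s, hs, hf⟩ := f.2
      refine ⟨_, ZFSet.mem_range_self (⟨s, hs⟩ : T.setoids), ?_⟩
      intro i hi i' hi' hii x x' hx hx'
      obtain ⟨i, rfl⟩ := ZFSet.mem_range.1 hi
      obtain ⟨i', rfl⟩ := ZFSet.mem_range.1 hi'
      rw [pair_mem_code hc] at hx hx'
      rw [hx, hx']
      obtain ⟨⟨⟨a, b⟩, hab⟩, h⟩ := ZFSet.mem_range.1 hii
      rw [ZFSet.pair_inj] at h
      obtain ⟨h1, h2⟩ := h
      have h1 := hc h1
      have h2 := hc h2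
      simp only at h1 h2
      subst h1 h2
      exact hf _ _ hab

theorem codeE_iff (hc : Function.Injective c) {f g : T.Fn} :
    CodeE (T.codeFilter c) (T.code c g) (T.code c f) ↔ E g f := by
  constructor
  · rintro ⟨X, hX, h⟩
    obtain ⟨⟨X, hXF⟩, rfl⟩ := ZFSet.mem_range.1 hX
    refine Filter.mem_of_superset hXF fun i hi => ?_
    obtain ⟨x, y, hx, hy, hxy⟩ := h (c i) (ZFSet.mem_range.2 ⟨⟨i, hi⟩, rfl⟩)
    rw [pair_mem_code hc] at hx hy
    rw [hx, hy] at hxy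
    exact hxy
  · intro h
    refine ⟨_, ZFSet.mem_range_self (⟨{i | g i ∈ f i}, h⟩ : {X : Set I // X ∈ T.filter}), ?_⟩
    intro i hi
    obtain ⟨⟨i, hgf⟩, rfl⟩ := ZFSet.mem_range.1 hi
    exact ⟨g i, f i, (pair_mem_code hc).2 rfl, (pair_mem_code hc).2 rfl, hgf⟩

theorem codeTight_iff (hc : Function.Injective c) {f g : T.Fn} :
    CodeTight (codeIndex c) (T.code c g) (T.code c f) ↔ Tight g f := by
  have h : ∀ P : ZFSet.{u} → Prop, (∀ z ∈ codeIndex c, P z) ↔ ∀ i, P (c i) := fun P => by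
    simp [codeIndex]
  rw [CodeTight, h]
  simp only [pair_mem_code hc, forall_eq, exists_eq_left]
  exact forall_congr' fun i => or_comm

/-- Induction along `E`: closure under tight predecessors already forces the correct values, since
these predecessors exhaust the collapse. -/
theorem collapse_of_fragment (hc : Function.Injective c) {G : ZFSet.{u}}
    (hG : IsCollapseFragment (codeIndex c) (T.codeSetoids c) (T.codeFilter c) G) (f : T.Fn) :
    ∀ z, ZFSet.pair (T.code c f) z ∈ G → z = T.collapse f := by
  induction f using wellFounded_E.induction with
  | _ f ih =>
    intro z hz
    obtain ⟨-, h1, h2⟩ := hG _ _ hz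
    ext w
    rw [h1, mem_collapse_iff_tight]
    constructor
    · rintro ⟨F, hF, hE⟩
      obtain ⟨g, rfl⟩ := (isAdmCode_iff hc).1 (hG _ _ hF).1
      rw [codeE_iff hc] at hE
      rw [← mem_collapse_iff_tight, ih g hE w hF]
      exact collapse_mem_iff.2 hE
    · rintro ⟨g, hE, ht, rfl⟩
      obtain ⟨w, hw⟩ := h2 (T.code c g) ((isAdmCode_iff hc).2 ⟨g, rfl⟩) ((codeTight_iff hc).2 ht)
        ((codeE_iff hc).2 hE)
      exact ⟨T.code c g, ih g hE w hw ▸ hw, (codeE_iff hc).2 hE⟩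

/-- The fragment consists of the admissible functions with values in a transitive set `t` containing
`x` and `∅`. Tight predecessors of such functions again have values in `t`. -/
theorem exists_fragment (hc : Function.Injective c) (x : ZFSet.{u}) :
    ∃ G, IsCollapseFragment (codeIndex c) (T.codeSetoids c) (T.codeFilter c) G ∧
      ZFSet.pair (T.code c (T.const x)) (T.collapse (T.const x)) ∈ G := by
  set t : ZFSet.{u} := ZFSet.vonNeumann (Order.succ x.rank)
  have ht : t.IsTransitive := ZFSet.isTransitive_vonNeumann _
  have hx : x ∈ t := ZFSet.mem_vonNeumann_succ x
  have h0 : ∅ ∈ t := ZFSet.mem_vonNeumann.2 (by simp)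
  have := small_of_forall_mem (T := T) fun _ => t
  let G : ZFSet.{u} := ZFSet.range fun f : {f : T.Fn // ∀ i, f i ∈ t} =>
    ZFSet.pair (T.code c f.1) (T.collapse f.1)
  have hG : ∀ {F z}, ZFSet.pair F z ∈ G ↔
      ∃ f : T.Fn, (∀ i, f i ∈ t) ∧ T.code c f = F ∧ T.collapse f = z := by
    intro F z
    simp only [G, ZFSet.mem_range, ZFSet.pair_inj, Subtype.exists, exists_prop]
  have hmem : ∀ {f g : T.Fn}, (∀ i, f i ∈ t) → Tight g f → ∀ i, g i ∈ t := by
    intro f g hf hg i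
    rcases hg i with h | h
    · exact ht.mem_trans h (hf i)
    · exact h ▸ h0
  refine ⟨G, ?_, hG.2 ⟨T.const x, fun _ => hx, rfl, rfl⟩⟩
  intro F z hF
  obtain ⟨f, hf, rfl, rfl⟩ := hG.1 hF
  refine ⟨(isAdmCode_iff hc).2 ⟨f, rfl⟩, fun w => ?_, ?_⟩
  · constructor
    · intro hw
      obtain ⟨g, hE, hg, rfl⟩ := mem_collapse_iff_tight.1 hw
      exact ⟨_, hG.2 ⟨g, hmem hf hg, rfl, rfl⟩, (codeE_iff hc).2 hE⟩
    · rintro ⟨_, hg, hE⟩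
      obtain ⟨g, -, rfl, rfl⟩ := hG.1 hg
      exact collapse_mem_iff.2 ((codeE_iff hc).1 hE)
  · intro F' hF' hT hE
    obtain ⟨g, rfl⟩ := (isAdmCode_iff hc).1 hF'
    exact ⟨_, hG.2 ⟨g, hmem hf ((codeTight_iff hc).1 hT), rfl, rfl⟩⟩

theorem isEmbeddingGraph_iff (hc : Function.Injective c) {x y : ZFSet.{u}} :
    IsEmbeddingGraph (codeIndex c) (T.codeSetoids c) (T.codeFilter c) x y ↔
      T.collapse (T.const x) = y := by
  constructor
  · rintro ⟨G, hG, F, hF, h⟩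
    obtain ⟨f, rfl⟩ := (isAdmCode_iff hc).1 (hG _ _ hF).1
    have hfx : f = T.const x := Subtype.ext (funext fun i =>
      h (c i) (ZFSet.mem_range_self i) _ ((pair_mem_code hc).2 rfl))
    subst hfx
    exact (collapse_of_fragment hc hG _ _ hF).symm
  · rintro rfl
    obtain ⟨G, hG, h⟩ := exists_fragment (T := T) hc x
    refine ⟨G, hG, _, h, fun i hi z hz => ?_⟩
    obtain ⟨i, rfl⟩ := ZFSet.mem_range.1 hi
    exact (pair_mem_code hc).1 hz

theorem isDefinableMap_embedding (hc : Function.Injective c) : IsDefinableMap T.embedding := by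
  refine SetFormula.definable₂ SetFormula.embeddingGraph
    (fun n => match n with
      | 0 => codeIndex c | 1 => T.codeSetoids c | _ => T.codeFilter c) _ fun x y => ?_
  rw [SetFormula.eval_embeddingGraph]
  exact (isEmbeddingGraph_iff hc).symm

end UltraSystem

open FirstOrder Cardinal Set SetFormula

/-! ### Elementary embeddings with critical point `κ` -/

section Embedding

variable {κ : Cardinal.{u}} {M : Set ZFSet.{u}} {j : ZFSet.{u} ↪ₑ[setLanguage] M}

theorem map_mem_map_iff {x y : ZFSet.{u}} :
    (j x : ZFSet.{u}) ∈ (j y : ZFSet.{u}) ↔ x ∈ y :=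
  (eval_elementary j (mem 0 1) fun | 0 => x | _ => y).symm

theorem map_subset_map (hM : IsTransitiveClass M) {x y : ZFSet.{u}} (h : x ⊆ y) :
    (j x : ZFSet.{u}) ⊆ j y := by
  have h1 := Bounded.transfer j hM (φ := allIn 2 0 (mem 2 1)) (by simp) fun | 0 => x | _ => y
  simp at h1
  exact fun z => h1.1 (fun z => @h z) z

theorem notMem_map_empty (hM : IsTransitiveClass M) (x : ZFSet.{u}) :
    x ∉ (j ∅ : ZFSet.{u}) := by
  have h1 := Bounded.transfer j hM (φ := allIn 1 0 bot) (by simp) fun _ => ∅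
  simp at h1
  exact h1 x

/-- The embedding is cofinal. -/
theorem exists_mem_map (hM : IsTransitiveClass M) (x : ZFSet.{u}) :
    x ∈ M → ∃ a, x ∈ (j a : ZFSet.{u}) := by
  induction x using ZFSet.inductionOn with
  | _ x ih =>
    intro hx
    choose a ha using fun y : {y // y ∈ x} => ih y y.2 (hM x hx y y.2)
    let A : ZFSet.{u} := ZFSet.iUnion a
    have hA : ∀ y ∈ x, y ∈ (j A : ZFSet.{u}) := fun y hy =>
      map_subset_map hM (ZFSet.subset_iUnion a ⟨y, hy⟩) (ha ⟨y, hy⟩)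
    -- The formula says that every subset of `A` is in its power set. Its outer quantifier is
    -- unbounded, so it is read in `M`, where it applies to `x`.
    have h1 := eval_elementary j (all 0 (imp (allIn 1 0 (mem 1 2)) (mem 0 3)))
      fun | 2 => A | _ => A.powerset
    simp at h1
    exact ⟨_, h1.1 (fun y hy z => hy z) x hx fun y _ hy => hA y hy⟩

theorem pair_mem_class (hM : IsTransitiveClass M) (j : ZFSet.{u} ↪ₑ[setLanguage] M)
    {x y : ZFSet.{u}} (hx : x ∈ M) (hy : y ∈ M) : ZFSet.pair x y ∈ M := by
  obtain ⟨a, ha⟩ := exists_mem_map (j := j) hM x hx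
  obtain ⟨b, hb⟩ := exists_mem_map (j := j) hM y hy
  have h1 := Bounded.transfer j hM
    (φ := allIn 0 4 (allIn 1 5 (exIn 2 6 (isPair 2 0 1 10)))) (by simp)
    fun | 4 => a | 5 => b | _ => ZFSet.prod a b
  simp [eval_isPair] at h1
  exact hM _ (j (a.prod b)).2 _ (h1.1 (fun x hx y hy => ⟨hx, hy⟩) x ha y hb)

/-- Enumerate the family along some `ν < κ`. Its image is enumerated along `j(ν) = ν`, and every
index `b < ν` is fixed by `j`. -/
theorem mem_map_range (hM : IsTransitiveClass M) (hj : HasCrit j κ) {ι : Type (u + 1)}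
    [Small.{u} ι] (hι : #ι < Cardinal.lift.{u + 1} κ) (t : ι → ZFSet.{u}) {y : ZFSet.{u}}
    (hy : y ∈ (j (ZFSet.range t) : ZFSet.{u})) : ∃ i, y = j (t i) := by
  obtain ⟨ν, hν⟩ := Cardinal.mem_range_lift_of_le hι.le
  have hνκ : ν < κ := by rwa [← hν, Cardinal.lift_lt] at hι
  have ha : ν.ord < κ.ord := Cardinal.ord_lt_ord.2 hνκ
  obtain ⟨e⟩ : Nonempty (Iio ν.ord ≃ ι) := by
    rw [← Cardinal.eq, Cardinal.mk_Iio_ordinal, Cardinal.card_ord, hν]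
  let h : ZFSet.{u} := ZFSet.range fun ξ : Iio ν.ord =>
    ZFSet.pair (ξ : Ordinal.{u}).toZFSet (t (e ξ))
  have h1 := Bounded.transfer j hM (φ := allIn 0 1 (exIn 2 3 (pairMem 2 0 4 10))) (by simp)
    fun | 1 => ZFSet.range t | 3 => ν.ord.toZFSet | _ => h
  simp [eval_pairMem] at h1
  obtain ⟨x, hx, hxy⟩ := h1.1 (fun i => ⟨_, Ordinal.toZFSet_mem_toZFSet_iff.2 (e.symm i).2,
    ZFSet.mem_range.2 ⟨e.symm i, by simp⟩⟩) y hy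
  rw [hj.1 _ ha] at hx
  obtain ⟨b, hb, rfl⟩ := Ordinal.mem_toZFSet_iff.1 hx
  have h2 := Bounded.transfer j hM (φ := allIn 0 1 (imp (pairMem 2 0 4 10) (eq 0 5))) (by simp)
    fun | 1 => ZFSet.range t | 2 => b.toZFSet | 4 => h | _ => t (e ⟨b, hb⟩)
  simp [eval_pairMem] at h2
  refine ⟨e ⟨b, hb⟩, h2.1 (fun i hi => ?_) y hy (by rwa [hj.1 b (hb.trans ha)])⟩
  obtain ⟨ξ, hξ⟩ := ZFSet.mem_range.1 hi
  obtain ⟨h3, h4⟩ := ZFSet.pair_inj.1 hξ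
  have h5 : ξ = ⟨b, hb⟩ := Subtype.ext (Ordinal.toZFSet_injective h3)
  rw [← h4, h5]

end Embedding

/-! ### Reading off a function from a seed -/

/-- The relation coded by the second coordinates of the elements of `g`. -/
def SeedRel (g x y : ZFSet.{u}) : Prop := ∃ p ∈ g, ∃ s ∈ p, ZFSet.pair x y ∈ s

namespace SetFormula

/-- `SeedRel (v g) (v a) (v b)`. -/
def seedRel (g a b l : ℕ) : SetFormula := exIn l g (exIn (l + 1) l (pairMem a b (l + 1) (l + 2)))

@[simp] theorem bounded_seedRel (g a b l : ℕ) : (seedRel g a b l).Bounded := by simp [seedRel]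

theorem eval_seedRel {g a b l : ℕ} (hg : g < l) (ha : a < l) (hb : b < l) (v : ℕ → ZFSet.{u}) :
    (seedRel g a b l).Eval univ v ↔ SeedRel (v g) (v a) (v b) := by
  simp [seedRel, SeedRel, eval_pairMem, hg.ne, ha.ne, hb.ne, (show a < l + 2 by omega),
    (show b < l + 2 by omega), (show a ≠ l + 1 by omega), (show b ≠ l + 1 by omega)]

/-- The variable `y` is the only element of `v k` related by `v g` to `v b`. -/
def seedValue (g b y k : ℕ) : SetFormula :=
  allIn 19 k (iff (seedRel g b 19 20) (eq 19 y))

@[simp] theorem bounded_seedValue (g b y k : ℕ) : (seedValue g b y k).Bounded := by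
  simp [seedValue]

theorem eval_seedValue {g b y k : ℕ} (hg : g < 19) (hb : b < 19) (hy : y < 19) (hk : k < 19)
    (v : ℕ → ZFSet.{u}) : (seedValue g b y k).Eval univ v ↔
      ∀ z ∈ v k, SeedRel (v g) (v b) z ↔ z = v y := by
  simp [seedValue, eval_seedRel, hg.ne, hb.ne, hy.ne, hk.ne, (show g < 20 by omega),
    (show b < 20 by omega)]

end SetFormula

variable {κ : Cardinal.{u}} {α : Ordinal.{u}}

theorem ord_pos (hκ : ℵ₀ < κ) : 0 < κ.ord := by
  rw [Cardinal.lt_ord]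
  simpa using Cardinal.aleph0_pos.trans hκ

/-- The function coded by a seed. -/
noncomputable def readSeed [Nonempty (Iio κ.ord)] (g : ZFSet.{u}) (β : Iio α) : Iio κ.ord :=
  Classical.epsilon fun γ : Iio κ.ord => ∀ γ' : Iio κ.ord,
    SeedRel g (β : Ordinal.{u}).toZFSet (γ' : Ordinal.{u}).toZFSet ↔ γ' = γ

theorem readSeed_eq [Nonempty (Iio κ.ord)] {g : ZFSet.{u}} {β : Iio α} {γ : Iio κ.ord}
    (h : ∀ γ' : Iio κ.ord,
      SeedRel g (β : Ordinal.{u}).toZFSet (γ' : Ordinal.{u}).toZFSet ↔ γ' = γ) :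
    readSeed g β = γ := by
  have h1 := Classical.epsilon_spec (p := fun γ : Iio κ.ord => ∀ γ' : Iio κ.ord,
    SeedRel g (β : Ordinal.{u}).toZFSet (γ' : Ordinal.{u}).toZFSet ↔ γ' = γ) ⟨γ, h⟩
  exact (h _).1 ((h1 _).2 rfl)

theorem readSeed_congr [Nonempty (Iio κ.ord)] {g g' : ZFSet.{u}} {β : Iio α}
    (h : ∀ γ : Iio κ.ord, SeedRel g (β : Ordinal.{u}).toZFSet (γ : Ordinal.{u}).toZFSet ↔
      SeedRel g' (β : Ordinal.{u}).toZFSet (γ : Ordinal.{u}).toZFSet) :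
    (readSeed g β : Iio κ.ord) = readSeed g' β := by
  simp only [readSeed, h]

theorem forall_mem_toZFSet {a : Ordinal.{u}} {P : ZFSet.{u} → Prop} :
    (∀ z ∈ a.toZFSet, P z) ↔ ∀ b : Iio a, P (b : Ordinal.{u}).toZFSet := by
  constructor
  · exact fun h b => h _ (Ordinal.toZFSet_mem_toZFSet_iff.2 b.2)
  · intro h z hz
    obtain ⟨b, hb, rfl⟩ := Ordinal.mem_toZFSet_iff.1 hz
    exact h ⟨b, hb⟩

theorem toZFSet_mem_subsetToZFSet {X : Set (Iio κ.ord)} {γ : Iio κ.ord} :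
    (γ : Ordinal.{u}).toZFSet ∈ subsetToZFSet X ↔ γ ∈ X := by
  rw [subsetToZFSet, ZFSet.mem_sep]
  constructor
  · rintro ⟨-, a, ha, h⟩
    rwa [← Subtype.ext (Ordinal.toZFSet_injective h)]
  · exact fun h => ⟨Ordinal.toZFSet_mem_toZFSet_iff.2 γ.2, γ, h, rfl⟩

theorem subsetToZFSet_univ : subsetToZFSet (univ : Set (Iio κ.ord)) = κ.ord.toZFSet := by
  ext z
  rw [subsetToZFSet, ZFSet.mem_sep, Ordinal.mem_toZFSet_iff]
  simp

/-! ### Filters which glue a family of ultrafilters -/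

/-- The set `X` of functions depends only on the coordinates in `c`. -/
def SupportedOn (c : Set (Iio α)) (X : Set (Iio α → Iio κ.ord)) : Prop :=
  ∀ p q, (∀ β ∈ c, p β = q β) → p ∈ X → q ∈ X

theorem SupportedOn.mono {c c' : Set (Iio α)} {X : Set (Iio α → Iio κ.ord)}
    (h : SupportedOn c X) (hc : c ⊆ c') : SupportedOn c' X :=
  fun p q hpq => h p q fun β hβ => hpq β (hc hβ)

/-- The filter `F` glues the ultrafilters `U β` for `β ∈ d`: it is `κ`-complete, decides all sets
supported on at most `κ` coordinates, projects to `U β` in the coordinate `β`, and its coordinates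
are increasing. -/
structure IsGluingFilter (U : Iio α → Ultrafilter (Iio κ.ord)) (d : Set (Iio α))
    (F : Filter (Iio α → Iio κ.ord)) : Prop where
  neBot : F.NeBot
  complete : CardinalInterFilter F (Cardinal.lift.{u + 1} κ)
  ultra : ∀ c : Set (Iio α), #c ≤ Cardinal.lift.{u + 1} κ → ∀ X, SupportedOn c X →
    X ∈ F ∨ Xᶜ ∈ F
  mem : ∀ β ∈ d, ∀ X ∈ U β, {p | p β ∈ X} ∈ F
  lt : ∀ β ∈ d, ∀ γ ∈ d, β < γ → {p | p β < p γ} ∈ F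

/-! ### Seeds in the target of an embedding. -/

section Seeds

variable {M : Set ZFSet.{u}} (j : ZFSet.{u} ↪ₑ[setLanguage] M) (d : Set (Iio α))
  (η : Iio α → Ordinal.{u}) (b₀ : Iio α)

/-- A seed for the coordinates in `c`. -/
def IsSeed (c : Set (Iio α)) (f : ZFSet.{u}) : Prop :=
  ∀ x y, SeedRel f x y ↔ ∃ b ∈ insert b₀ (c ∩ d),
    x = (j (b : Ordinal.{u}).toZFSet : ZFSet.{u}) ∧ y = (η b).toZFSet

variable {j d η b₀}

/-- A Kuratowski pair is nonempty and omits `∅`, which every nonzero ordinal contains. So the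
element `(ξ, v)` of a seed, with `v` a pair, contributes only the pair `v` to `SeedRel`, never `ξ`.
-/
theorem pair_ne_toZFSet (x y : ZFSet.{u}) (a : Ordinal.{u}) : ZFSet.pair x y ≠ a.toZFSet := by
  intro h
  rcases eq_or_ne a 0 with rfl | ha
  · rw [Ordinal.toZFSet_zero] at h
    have h1 : ({x} : ZFSet.{u}) ∈ ZFSet.pair x y := by simp [ZFSet.pair]
    rw [h] at h1
    exact ZFSet.notMem_empty _ h1
  · have h1 : ∅ ∈ ZFSet.pair x y := by
      rw [h, ← Ordinal.toZFSet_zero, Ordinal.toZFSet_mem_toZFSet_iff]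
      exact pos_iff_ne_zero.2 ha
    rw [ZFSet.pair, ZFSet.mem_pair] at h1
    rcases h1 with h1 | h1
    · exact ZFSet.notMem_empty x (h1 ▸ ZFSet.mem_singleton.2 rfl)
    · exact ZFSet.notMem_empty x (h1 ▸ ZFSet.mem_pair.2 (Or.inl rfl))

/-- A seed is a `κ`-sequence of pairs `(j(b), η b)` in `M`, so closure puts it in `M`. The index
`b₀` keeps the enumerated set nonempty, so that `κ` maps onto it. -/
theorem exists_seed (hκ : ℵ₀ < κ) (hM : IsTransitiveClass M) (hcl : IsClosedUnderSeq M κ)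
    (hη : ∀ β ∈ d, (η β).toZFSet ∈ M) (hb₀ : b₀ ∈ d) (c : Set (Iio α))
    (hc : #c ≤ Cardinal.lift.{u + 1} κ) :
    ∃ f θ, IsSeed j d η b₀ c f ∧ f ∈ (j θ : ZFSet.{u}) := by
  have hc0 : #(insert b₀ (c ∩ d) : Set (Iio α)) ≤ #(Iio κ.ord) := by
    rw [Cardinal.mk_Iio_ordinal, Cardinal.card_ord]
    refine (Cardinal.mk_insert_le).trans ?_
    refine (add_le_add ((Cardinal.mk_le_mk_of_subset inter_subset_left).trans hc) le_rfl).trans ?_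
    rw [Cardinal.add_one_eq]
    simpa using hκ.le
  obtain ⟨emb⟩ := Cardinal.le_def _ _ |>.1 hc0
  have : Nonempty (insert b₀ (c ∩ d) : Set (Iio α)) := ⟨⟨b₀, mem_insert _ _⟩⟩
  obtain ⟨e, he⟩ : ∃ e : Iio κ.ord → (insert b₀ (c ∩ d) : Set (Iio α)), Function.Surjective e :=
    ⟨_, Function.invFun_surjective emb.injective⟩
  let val : Iio κ.ord → ZFSet.{u} := fun ξ =>
    ZFSet.pair (j ((e ξ).1 : Ordinal.{u}).toZFSet) (η (e ξ)).toZFSet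
  let f : ZFSet.{u} := ZFSet.range fun ξ : Iio κ.ord =>
    ZFSet.pair (ξ : Ordinal.{u}).toZFSet (val ξ)
  have hf : f ∈ M := by
    refine hcl (ZFSet.range val) f ?_ ⟨?_, ?_⟩
    · intro z hz
      obtain ⟨ξ, rfl⟩ := ZFSet.mem_range.1 hz
      refine pair_mem_class hM j (j _).2 (hη _ ?_)
      rcases (e ξ).2 with h | h
      · rw [h]; exact hb₀
      · exact h.2
    · intro z hz
      obtain ⟨ξ, rfl⟩ := ZFSet.mem_range.1 hz
      exact ZFSet.pair_mem_prod.2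
        ⟨Ordinal.toZFSet_mem_toZFSet_iff.2 ξ.2, ZFSet.mem_range_self ξ⟩
    · refine forall_mem_toZFSet.2 fun ξ => ⟨val ξ, ZFSet.mem_range_self ξ, fun w hw => ?_⟩
      obtain ⟨ξ', h⟩ := ZFSet.mem_range.1 hw
      obtain ⟨h1, rfl⟩ := ZFSet.pair_inj.1 h
      rw [Subtype.ext (Ordinal.toZFSet_injective h1)]
  obtain ⟨θ, hθ⟩ := exists_mem_map (j := j) hM f hf
  refine ⟨f, θ, fun x y => ?_, hθ⟩
  constructor
  · rintro ⟨p, hp, s, hs, hxy⟩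
    obtain ⟨ξ, rfl⟩ := ZFSet.mem_range.1 hp
    rw [ZFSet.pair, ZFSet.mem_pair] at hs
    have h1 : ZFSet.pair x y = (ξ : Ordinal.{u}).toZFSet ∨ ZFSet.pair x y = val ξ := by
      rcases hs with rfl | rfl
      · exact Or.inl (ZFSet.mem_singleton.1 hxy)
      · exact ZFSet.mem_pair.1 hxy
    have h2 := h1.resolve_left (pair_ne_toZFSet _ _ _)
    obtain ⟨h3, h4⟩ := ZFSet.pair_inj.1 h2
    exact ⟨(e ξ).1, (e ξ).2, h3, h4⟩
  · rintro ⟨b, hb, rfl, rfl⟩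
    obtain ⟨ξ, hξ⟩ := he ⟨b, hb⟩
    refine ⟨_, ZFSet.mem_range_self ξ, {(ξ : Ordinal.{u}).toZFSet, val ξ}, ?_, ?_⟩
    · simp [ZFSet.pair]
    · simp [val, hξ]

variable [Nonempty (Iio κ.ord)]

/-- The set of those elements of `θ` which code an element of `X`. -/
noncomputable def trace (θ : ZFSet.{u}) (X : Set (Iio α → Iio κ.ord)) : ZFSet.{u} :=
  ZFSet.sep (fun g => readSeed g ∈ X) θ

theorem mem_trace {θ g : ZFSet.{u}} {X : Set (Iio α → Iio κ.ord)} :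
    g ∈ trace θ X ↔ g ∈ θ ∧ readSeed g ∈ X := ZFSet.mem_sep

/-- Membership in the derived filter does not change when the seed is replaced by one for more
coordinates: in `V`, codes that agree on `c` read off functions that agree on `c`, and `Y` sees no
other coordinates. -/
theorem IsSeed.mem_trace_of_subset (hM : IsTransitiveClass M) {c c' : Set (Iio α)}
    {f f' θ θ' : ZFSet.{u}} (hf : IsSeed j d η b₀ c f) (hf' : IsSeed j d η b₀ c' f')
    (hfθ' : f' ∈ (j θ' : ZFSet.{u})) (hcc : c ⊆ c') {Y : Set (Iio α → Iio κ.ord)}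
    (hY : SupportedOn c Y) (h : f ∈ (j (trace θ Y) : ZFSet.{u})) :
    f' ∈ (j (trace θ' Y) : ZFSet.{u}) := by
  let C : ZFSet.{u} := ZFSet.range fun b : c => (b.1 : Ordinal.{u}).toZFSet
  have h1 := Bounded.transfer j hM
    (φ := allIn 10 1 (allIn 11 2 (imp (allIn 12 3 (allIn 13 4
      (iff (seedRel 10 12 13 20) (seedRel 11 12 13 20)))) (imp (mem 10 5) (mem 11 6)))))
    (by simp) fun
      | 1 => θ | 2 => θ' | 3 => C | 4 => κ.ord.toZFSet | 5 => trace θ Y | _ => trace θ' Y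
  simp [eval_seedRel] at h1
  refine h1.1 ?_ f ?_ f' hfθ' ?_ h
  · intro g hg g' hg' hgg h2
    rw [mem_trace] at h2 ⊢
    refine ⟨hg', hY _ _ (fun β hβ => ?_) h2.2⟩
    exact readSeed_congr (forall_mem_toZFSet.1 (hgg _ (ZFSet.mem_range.2 ⟨⟨β, hβ⟩, rfl⟩)))
  · exact map_subset_map hM (fun _ hz => (mem_trace.1 hz).1) h
  · intro x hx y hy
    rw [hf, hf']
    constructor
    · rintro ⟨b, hb, rfl, rfl⟩
      exact ⟨b, insert_subset_insert (inter_subset_inter_left d hcc) hb, rfl, rfl⟩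
    · rintro ⟨b, hb, rfl, rfl⟩
      refine ⟨b, ?_, rfl, rfl⟩
      -- A general element of `j(C)` need not be of the form `j(β)`, but a seed relates only such
      -- points, and `j(b) ∈ j(C)` gives `b ∈ c`.
      obtain ⟨⟨b', hb'⟩, h3⟩ := ZFSet.mem_range.1 (map_mem_map_iff.1 hx)
      have h4 : b' = b := Subtype.ext (Ordinal.toZFSet_injective h3)
      subst h4
      exact hb.imp id fun h => ⟨hb', h.2⟩

/-- With fewer than `κ` sets, `j` adds no members to the family of traces, so lying in each image
suffices. -/
theorem mem_trace_iInter (hM : IsTransitiveClass M) (hj : HasCrit j κ) {ι : Type (u + 1)}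
    [Small.{u} ι] (hι : #ι < Cardinal.lift.{u + 1} κ) {f θ : ZFSet.{u}}
    (hf : f ∈ (j θ : ZFSet.{u})) (Y : ι → Set (Iio α → Iio κ.ord))
    (h : ∀ i, f ∈ (j (trace θ (Y i)) : ZFSet.{u})) :
    f ∈ (j (trace θ (⋂ i, Y i)) : ZFSet.{u}) := by
  have h1 := Bounded.transfer j hM
    (φ := allIn 0 1 (imp (allIn 2 3 (mem 0 2)) (mem 0 4))) (by simp) fun
      | 1 => θ | 3 => ZFSet.range fun i => trace θ (Y i) | _ => trace θ (⋂ i, Y i)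
  simp at h1
  refine h1.1 ?_ f hf ?_
  · intro g hg hgY
    exact mem_trace.2 ⟨hg, mem_iInter.2 fun i => (mem_trace.1 (hgY i)).2⟩
  · intro z hz
    obtain ⟨i, rfl⟩ := mem_map_range hM hj hι _ hz
    exact h i

theorem IsSeed.seedValue (hf : IsSeed j d η b₀ c f) {β : Iio α} (hβ : β ∈ c ∩ d)
    (z : ZFSet.{u}) : SeedRel f (j (β : Ordinal.{u}).toZFSet) z ↔ z = (η β).toZFSet := by
  rw [hf]
  constructor
  · rintro ⟨b, hb, h1, rfl⟩
    have h2 : b = β :=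
      Subtype.ext (Ordinal.toZFSet_injective (j.injective (Subtype.ext h1))).symm
    rw [h2]
  · rintro rfl
    exact ⟨β, Or.inr hβ, rfl, rfl⟩

end Seeds

/-- An embedding gluing the ultrafilters `U β` for `β ∈ d` yields a gluing filter. -/
theorem exists_isGluingFilter (hκ : ℵ₀ < κ) (U : Iio α → Ultrafilter (Iio κ.ord))
    (d : Set (Iio α)) (hd : d.Nonempty) {M : Set ZFSet.{u}} (j : ZFSet.{u} ↪ₑ[setLanguage] M)
    (hM : IsTransitiveClass M) (hj : HasCrit j κ) (hcl : IsClosedUnderSeq M κ)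
    (η : Iio α → Ordinal.{u}) (hmono : StrictMonoOn η d)
    (hη : ∀ β ∈ d, ∀ X ∈ U β, (η β).toZFSet ∈ (j (subsetToZFSet X) : ZFSet.{u})) :
    ∃ F, IsGluingFilter U d F := by
  have : Nonempty (Iio κ.ord) := ⟨⟨0, ord_pos hκ⟩⟩
  obtain ⟨b₀, hb₀⟩ := hd
  have hηκ : ∀ β ∈ d, (η β).toZFSet ∈ (j κ.ord.toZFSet : ZFSet.{u}) := fun β hβ => by
    rw [← subsetToZFSet_univ]
    exact hη β hβ univ Filter.univ_mem
  have hseed := exists_seed (j := j) hκ hM hcl (fun β hβ => hM _ (j _).2 _ (hηκ β hβ)) hb₀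
  have hfin : ∀ c : Set (Iio α), c.Finite → #c ≤ Cardinal.lift.{u + 1} κ := fun c hc =>
    (Cardinal.lt_aleph0_iff_set_finite.2 hc).le.trans (by simpa using hκ.le)
  -- The derived filter: `X` belongs if it contains a set `Y` of small support such that a seed for
  -- that support lies in the image of the codes reading into `Y`.
  let l : Set (Set (Iio α → Iio κ.ord)) := {X | ∃ (c : Set (Iio α)) (f θ : ZFSet.{u})
    (Y : Set (Iio α → Iio κ.ord)), #c ≤ Cardinal.lift.{u + 1} κ ∧ IsSeed j d η b₀ c f ∧
      SupportedOn c Y ∧ Y ⊆ X ∧ f ∈ (j (trace θ Y) : ZFSet.{u})}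
  have hmono' : ∀ X Y, X ∈ l → X ⊆ Y → Y ∈ l := by
    rintro X Y ⟨c, f, θ, Z, h1, h2, h3, h4, h5⟩ h
    exact ⟨c, f, θ, Z, h1, h2, h3, h4.trans h, h5⟩
  have hinter : ∀ S : Set (Set (Iio α → Iio κ.ord)), #S < Cardinal.lift.{u + 1} κ → S ⊆ l →
      ⋂₀ S ∈ l := by
    intro S hS hSl
    choose c f θ Y hc hf hY hYX hfY using fun s : S => hSl s.2
    -- Fewer than `κ` supports of size at most `κ` have a union of size at most `κ`, so a single
    -- seed serves them all.
    have hcU : #(⋃ s, c s : Set (Iio α)) ≤ Cardinal.lift.{u + 1} κ := by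
      refine (Cardinal.mk_iUnion_le_sum_mk).trans ((Cardinal.sum_le_sum _ _ hc).trans ?_)
      rw [Cardinal.sum_const']
      refine (mul_le_mul' hS.le le_rfl).trans ?_
      rw [Cardinal.mul_eq_self]
      simpa using hκ.le
    obtain ⟨g, θ', hg, hgθ⟩ := hseed _ hcU
    have : Small.{u} S := by
      rw [Cardinal.small_iff_lift_mk_lt_univ, Cardinal.lift_id]
      exact hS.trans (Cardinal.lift_lt_univ' _)
    refine ⟨_, g, θ', ⋂ s, Y s, hcU, hg, ?_, ?_, mem_trace_iInter hM hj hS hgθ Y fun s =>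
      (hf s).mem_trace_of_subset hM hg hgθ (subset_iUnion c s) (hY s) (hfY s)⟩
    · intro p q hpq hp
      rw [mem_iInter] at hp ⊢
      exact fun s => ((hY s).mono (subset_iUnion c s)) p q hpq (hp s)
    · exact fun p hp s hs => hYX ⟨s, hs⟩ (mem_iInter.1 hp ⟨s, hs⟩)
  have h2 : (2 : Cardinal.{u + 1}) < Cardinal.lift.{u + 1} κ :=
    lt_trans (b := ℵ₀) (by exact_mod_cast Cardinal.natCast_lt_aleph0 (n := 2)) (by simpa using hκ)
  refine ⟨Filter.ofCardinalInter l h2 hinter hmono', ?_, inferInstance, ?_, ?_, ?_⟩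
  · refine ⟨fun hbot => ?_⟩
    have h3 : (∅ : Set (Iio α → Iio κ.ord)) ∈ Filter.ofCardinalInter l h2 hinter hmono' := by
      rw [hbot]; trivial
    obtain ⟨c, f, θ, Y, -, -, -, hY, hf⟩ := h3
    refine notMem_map_empty (j := j) hM f (map_subset_map hM (fun z hz => ?_) hf)
    exact (hY (mem_trace.1 hz).2).elim
  · intro c hc X hX
    obtain ⟨f, θ, hf, hfθ⟩ := hseed c hc
    have h3 := Bounded.transfer j hM (φ := allIn 0 1 (or (mem 0 2) (mem 0 3))) (by simp) fun
      | 1 => θ | 2 => trace θ X | _ => trace θ Xᶜ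
    simp at h3
    rcases h3.1 (fun g hg => (Classical.em (readSeed g ∈ X)).imp
      (fun h => mem_trace.2 ⟨hg, h⟩) fun h => mem_trace.2 ⟨hg, h⟩) f hfθ with h | h
    · exact Or.inl ⟨c, f, θ, X, hc, hf, hX, subset_rfl, h⟩
    · exact Or.inr ⟨c, f, θ, Xᶜ, hc, hf,
        fun p q hpq hp hq => hp (hX q p (fun β hβ => (hpq β hβ).symm) hq), subset_rfl, h⟩
  · intro β hβ X hX
    obtain ⟨f, θ, hf, hfθ⟩ := hseed {β} (hfin _ (finite_singleton β))
    refine ⟨{β}, f, θ, _, hfin _ (finite_singleton β), hf, ?_, subset_rfl, ?_⟩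
    · intro p q hpq hp
      change q β ∈ X
      rw [← hpq β rfl]
      exact hp
    -- In `V`: a code whose value at `β` is `y ∈ X` lies in the trace. The image of this under `j`
    -- is applied to the seed `f` and `y = η β`.
    · have h3 := Bounded.transfer j hM
        (φ := allIn 10 1 (allIn 11 4 (imp (seedValue 10 3 11 4) (imp (mem 11 6) (mem 10 5)))))
        (by simp) fun
          | 1 => θ | 3 => (β : Ordinal.{u}).toZFSet | 4 => κ.ord.toZFSet
          | 5 => trace θ {p : Iio α → Iio κ.ord | p β ∈ X} | _ => subsetToZFSet X
      simp [SetFormula.eval_seedValue] at h3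
      refine h3.1 ?_ f hfθ _ (hηκ β hβ) (fun z _ => hf.seedValue ⟨rfl, hβ⟩ z) (hη β hβ X hX)
      intro g hg y hy hval hyX
      obtain ⟨γ, hγ, rfl⟩ := Ordinal.mem_toZFSet_iff.1 hy
      have h4 : (readSeed g β : Iio κ.ord) = ⟨γ, hγ⟩ := readSeed_eq fun γ' => by
        rw [forall_mem_toZFSet.1 hval γ', Ordinal.toZFSet_injective.eq_iff, Subtype.ext_iff]
      refine mem_trace.2 ⟨hg, ?_⟩
      rw [mem_ofPred_eq, h4]
      exact toZFSet_mem_subsetToZFSet.1 hyX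
  · intro β hβ β' hβ' hlt
    obtain ⟨f, θ, hf, hfθ⟩ := hseed {β, β'} (hfin _ (toFinite _))
    refine ⟨{β, β'}, f, θ, _, hfin _ (toFinite _), hf, ?_, subset_rfl, ?_⟩
    · intro p q hpq hp
      change q β < q β'
      rw [← hpq β (by simp), ← hpq β' (by simp)]
      exact hp
    · have h3 := Bounded.transfer j hM
        (φ := allIn 10 1 (allIn 11 4 (allIn 12 4 (imp (seedValue 10 2 11 4)
          (imp (seedValue 10 3 12 4) (imp (mem 11 12) (mem 10 5)))))))
        (by simp) fun
          | 1 => θ | 2 => (β : Ordinal.{u}).toZFSet | 3 => (β' : Ordinal.{u}).toZFSet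
          | 4 => κ.ord.toZFSet | _ => trace θ {p : Iio α → Iio κ.ord | p β < p β'}
      simp [SetFormula.eval_seedValue] at h3
      refine h3.1 ?_ f hfθ _ (hηκ β hβ) _ (hηκ β' hβ')
        (fun z _ => hf.seedValue ⟨by simp, hβ⟩ z) (fun z _ => hf.seedValue ⟨by simp, hβ'⟩ z)
        (Ordinal.toZFSet_mem_toZFSet_iff.2 (hmono hβ hβ' hlt))
      intro g hg y hy y' hy' hval hval' hyy
      obtain ⟨γ, hγ, rfl⟩ := Ordinal.mem_toZFSet_iff.1 hy
      obtain ⟨γ', hγ', rfl⟩ := Ordinal.mem_toZFSet_iff.1 hy'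
      have h4 : (readSeed g β : Iio κ.ord) = ⟨γ, hγ⟩ := readSeed_eq fun z => by
        rw [forall_mem_toZFSet.1 hval z, Ordinal.toZFSet_injective.eq_iff, Subtype.ext_iff]
      have h5 : (readSeed g β' : Iio κ.ord) = ⟨γ', hγ'⟩ := readSeed_eq fun z => by
        rw [forall_mem_toZFSet.1 hval' z, Ordinal.toZFSet_injective.eq_iff, Subtype.ext_iff]
      refine mem_trace.2 ⟨hg, ?_⟩
      rw [mem_ofPred_eq, h4, h5]
      exact Ordinal.toZFSet_mem_toZFSet_iff.1 hyy

/-! ### From gluing filters to gluing embeddings -/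

/-- Agreement of functions on the coordinates in `c`. -/
def agreeOn (κ : Cardinal.{u}) (c : Set (Iio α)) : Setoid (Iio α → Iio κ.ord) where
  r p q := ∀ β ∈ c, p β = q β
  iseqv := ⟨fun _ _ _ => rfl, fun h β hβ => (h β hβ).symm,
    fun h h' β hβ => (h β hβ).trans (h' β hβ)⟩

namespace IsGluingFilter

variable {U : Iio α → Ultrafilter (Iio κ.ord)} {F : Filter (Iio α → Iio κ.ord)}

/-- The ultrapower data of a gluing filter. -/
def ultraSystem {d : Set (Iio α)} (hF : IsGluingFilter U d F) (hκ : ℵ₀ < κ) :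
    UltraSystem κ (Iio α → Iio κ.ord) where
  filter := F
  setoids := agreeOn κ '' {c | #c ≤ Cardinal.lift.{u + 1} κ}
  neBot := hF.neBot
  complete := hF.complete
  aleph0_lt := hκ
  nonempty := ⟨_, ∅, by simp, rfl⟩
  directed := by
    intro s hs
    choose c hc hcs using hs
    refine ⟨_, ⟨⋃ ξ, c ξ, ?_, rfl⟩, fun ξ p q hpq => ?_⟩
    · refine (Cardinal.mk_iUnion_le_sum_mk).trans ((Cardinal.sum_le_sum _ _ hc).trans ?_)
      rw [Cardinal.sum_const', Cardinal.mk_Iio_ordinal, Cardinal.card_ord, Cardinal.mul_eq_self]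
      simpa using hκ.le
    · rw [← hcs]
      exact fun β hβ => hpq β (mem_iUnion.2 ⟨ξ, hβ⟩)
  ultra := by
    rintro _ ⟨c, hc, rfl⟩ P hP
    exact hF.ultra c hc {p | P p} fun p q hpq hp => (hP p q hpq).mp hp

/-- The functions reading off a coordinate. -/
noncomputable def coordinate {d : Set (Iio α)} (hF : IsGluingFilter U d F) (hκ : ℵ₀ < κ)
    (β : Iio α) : (hF.ultraSystem hκ).Fn :=
  ⟨fun p => (p β : Ordinal.{u}).toZFSet, agreeOn κ {β}, ⟨{β}, by
    rw [mem_ofPred_eq, Cardinal.mk_singleton]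
    exact Cardinal.one_le_aleph0.trans (by simpa using hκ.le), rfl⟩,
    fun p q hpq => congrArg (fun z : Iio κ.ord => (z : Ordinal.{u}).toZFSet) (hpq β rfl)⟩

/-- A gluing filter yields a gluing embedding. -/
theorem exists_embedding (hF : IsGluingFilter U univ F) (hκ : ℵ₀ < κ) (hα : 0 < α)
    (hU : ∀ β a, {a} ∉ U β) :
    ∃ (M : Set ZFSet.{u}) (j : ZFSet.{u} ↪ₑ[setLanguage] M),
      IsTransitiveClass M ∧ IsDefinableMap j ∧ HasCrit j κ ∧ IsClosedUnderSeq M κ ∧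
      ∃ η : Iio α → Ordinal.{u}, StrictMono η ∧
        ∀ (β : Iio α) (X : Set (Iio κ.ord)),
          X ∈ U β ↔ (η β).toZFSet ∈ (j (subsetToZFSet X) : ZFSet.{u}) := by
  let T := hF.ultraSystem hκ
  let h : Iio α → T.Fn := hF.coordinate hκ
  -- The projection of `F` extends the ultrafilter `U β`, and a proper filter extending an
  -- ultrafilter equals it.
  have hmem : ∀ β X, X ∈ U β ↔ {p | p β ∈ X} ∈ F := by
    intro β X
    refine ⟨hF.mem β trivial X, fun hX => ?_⟩
    by_contra hn
    have h1 := hF.mem β trivial Xᶜ ((U β).compl_mem_iff_notMem.2 hn)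
    have := hF.neBot
    obtain ⟨p, hp, hp'⟩ := Filter.nonempty_of_mem (Filter.inter_mem hX h1)
    exact hp' hp
  -- Coordinate `0` is not eventually constant, since a constant value `a` would put `{a}` into the
  -- nonprincipal `U 0`.
  have hmoves : T.Moves := by
    refine ⟨h ⟨0, hα⟩, fun p => Ordinal.toZFSet_mem_toZFSet_iff.2 (p ⟨0, hα⟩).2, fun a ha hp => ?_⟩
    refine hU ⟨0, hα⟩ ⟨a, ha⟩ ((hmem _ _).2 (Filter.mem_of_superset hp fun p hp => ?_))
    exact Subtype.ext (Ordinal.toZFSet_injective hp)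
  have hord : ∀ β, (T.collapse (h β)).rank.toZFSet = T.collapse (h β) := fun β =>
    (UltraSystem.isOrdinal_collapse _ (Filter.Eventually.of_forall fun p =>
      ZFSet.isOrdinal_toZFSet _)).toZFSet_rank_eq
  let code : (Iio α → Iio κ.ord) → ZFSet.{u} := fun p =>
    ZFSet.range fun β : Iio α => ZFSet.pair (β : Ordinal.{u}).toZFSet (p β : Ordinal.{u}).toZFSet
  have hcode : Function.Injective code := by
    intro p q hpq
    funext β
    have h1 : ZFSet.pair (β : Ordinal.{u}).toZFSet (p β : Ordinal.{u}).toZFSet ∈ code q :=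
      hpq ▸ ZFSet.mem_range.2 ⟨β, rfl⟩
    obtain ⟨β', h2⟩ := ZFSet.mem_range.1 h1
    obtain ⟨h3, h4⟩ := ZFSet.pair_inj.1 h2
    have h5 : β' = β := Subtype.ext (Ordinal.toZFSet_injective h3)
    rw [← h5]
    subst h5
    exact (Subtype.ext (Ordinal.toZFSet_injective h4)).symm
  refine ⟨T.target, T.embedding, UltraSystem.isTransitive_target,
    UltraSystem.isDefinableMap_embedding hcode, UltraSystem.hasCrit hmoves,
    UltraSystem.isClosedUnderSeq_target hmoves, fun β => (T.collapse (h β)).rank, ?_, ?_⟩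
  · intro β γ hβγ
    rw [← Ordinal.toZFSet_mem_toZFSet_iff, hord, hord, UltraSystem.collapse_mem_iff]
    exact Filter.mem_of_superset (hF.lt β trivial γ trivial hβγ) fun p hp =>
      Ordinal.toZFSet_mem_toZFSet_iff.2 hp
  · intro β X
    rw [hord, UltraSystem.coe_embedding, UltraSystem.collapse_mem_iff, hmem]
    refine Filter.congr_sets (Filter.Eventually.of_forall fun p => ?_)
    exact toZFSet_mem_subsetToZFSet.symm

end IsGluingFilter

/-! ### The main theorem -/

/-- An infinite set of ordinals of cardinality less than `μ` is order isomorphic to an infinite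
ordinal below `μ`. -/
theorem exists_orderIso_of_mk_lt {μ : Cardinal.{u}} (d : Set (Iio α)) (h0 : ℵ₀ ≤ #d)
    (hd : #d < Cardinal.lift.{u + 1} μ) :
    ∃ δ : Ordinal.{u}, Ordinal.omega0 ≤ δ ∧ δ < μ.ord ∧ Nonempty (d ≃o Iio δ) := by
  have h1 : Ordinal.type (α := d) (· < ·) < Ordinal.lift.{u + 1} μ.ord := by
    rw [Cardinal.lift_ord, Cardinal.lt_ord, Ordinal.card_type]
    exact hd
  obtain ⟨δ, hδ⟩ := Ordinal.mem_range_lift_of_le h1.le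
  have hiso : Ordinal.type (α := d) (· < ·) = Ordinal.type (α := Iio δ) (· < ·) := by
    rw [Ordinal.type_lt_Iio, hδ]
  obtain ⟨e⟩ := Ordinal.type_eq.1 hiso
  refine ⟨δ, ?_, ?_, ⟨OrderIso.ofRelIsoLT e⟩⟩
  · rw [← Ordinal.aleph0_le_card, ← Cardinal.aleph0_le_lift.{u, u + 1}, Ordinal.lift_card, hδ,
      Ordinal.card_type]
    exact h0
  · rwa [← hδ, Ordinal.lift_lt] at h1

/-- The gluing property concerns sequences indexed by ordinals, so the family on `d` is reindexed by
its order type. The seeds are defined as `0` off `d`, where nothing is required of them. -/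
theorem exists_isGluingFilter_of_hasGPBelow {μ : Cardinal.{u}} (hκ : ℵ₀ < κ)
    (hGP : HasGPBelow κ μ.ord) (U : Iio α → Ultrafilter (Iio κ.ord))
    (hU : ∀ β, IsNonprincipalComplete κ (U β)) (d : Set (Iio α)) (h0 : ℵ₀ ≤ #d)
    (hd : #d < Cardinal.lift.{u + 1} μ) : ∃ F, IsGluingFilter U d F := by
  obtain ⟨δ, hδ0, hδ, ⟨e⟩⟩ := exists_orderIso_of_mk_lt d h0 hd
  obtain ⟨M, j, hM, -, hj, hcl, η, hη, hUη⟩ := hGP δ hδ0 hδ (fun ξ => U (e.symm ξ)) fun ξ => hU _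
  have hne : d.Nonempty := by
    rw [nonempty_iff_ne_empty]
    rintro rfl
    simp [Cardinal.aleph0_ne_zero] at h0
  classical
  refine exists_isGluingFilter hκ U d hne j hM hj hcl
    (fun β => if h : β ∈ d then η (e ⟨β, h⟩) else 0) ?_ ?_
  · intro β hβ γ hγ hβγ
    simp only [dif_pos hβ, dif_pos hγ]
    exact hη (e.strictMono hβγ)
  · intro β hβ X hX
    simp only [dif_pos hβ]
    rw [← hUη]
    simpa using hX

/-- The complement is a union of fewer than `μ` singletons, each of them null for `D`. -/
theorem Ioi_mem {μ : Cardinal.{u}} (hμ : ℵ₀ ≤ μ) {D : Ultrafilter (Iio μ.ord)} (hD : IsNonprincipalComplete μ D)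
    (ξ : Iio μ.ord) : {ζ | ξ < ζ} ∈ D := by
  have := hD.2
  have hlim : #(Iic ξ) < Cardinal.lift.{u + 1} μ := by
    have hs : Order.succ ξ.1 < μ.ord := (Cardinal.isSuccLimit_ord hμ).succ_lt ξ.2
    refine lt_of_le_of_lt ?_ (UltraSystem.mk_Iio_lt hs)
    exact Cardinal.mk_le_of_injective (f := fun a : Iic ξ =>
      (⟨a.1.1, mem_Iio.2 (Order.lt_succ_iff.2 (show a.1.1 ≤ ξ.1 from a.2))⟩ : Iio (Order.succ ξ.1))) fun a b hab =>
        Subtype.ext (Subtype.ext (congrArg (fun z : Iio (Order.succ ξ.1) => z.1) hab))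
  have h1 : ∀ᶠ ζ : Iio μ.ord in (D : Filter (Iio μ.ord)), ∀ a : Iic ξ, ζ ≠ (a : Iio μ.ord) :=
    (Filter.eventually_cardinal_forall hlim).2 fun a => by
      have := D.compl_mem_iff_notMem.2 (hD.1 a)
      exact this
  refine Filter.mem_of_superset h1 fun ζ hζ => ?_
  by_contra hn
  exact hζ ⟨ζ, mem_Iic.2 (not_lt.1 hn)⟩ rfl

theorem hasGPBelow_succ {μ : Cardinal.{u}} (hκ : ℵ₀ < κ) (hμ : IsMeasurableCardinal μ)
    (hκμ : κ ≤ μ) (hGP : HasGPBelow κ μ.ord) : HasGPBelow κ (Order.succ μ).ord := by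
  intro α hα0 hα
  rcases lt_or_ge α μ.ord with hlt | hge
  · exact hGP α hα0 hlt
  intro U hU
  obtain ⟨hμ0, D, hD⟩ := hμ
  have hcard : α.card = μ :=
    le_antisymm (Order.lt_succ_iff.1 (Cardinal.lt_ord.1 hα)) (Cardinal.ord_le.1 hge)
  obtain ⟨b⟩ : Nonempty (Iio α ≃ Iio μ.ord) := by
    rw [← Cardinal.eq, Cardinal.mk_Iio_ordinal, Cardinal.mk_Iio_ordinal, hcard, Cardinal.card_ord]
  have hω : Ordinal.omega0 < μ.ord := by
    rw [← Cardinal.ord_aleph0]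
    exact Cardinal.ord_lt_ord.2 hμ0
  -- The maximum with `ω` makes every `d ξ` infinite, as gluing is assumed for infinite lengths
  -- only.
  let d : Iio μ.ord → Set (Iio α) := fun ξ => {β | (b β : Ordinal.{u}) < max ξ.1 Ordinal.omega0}
  have hd : ∀ ξ, #(d ξ) = Cardinal.lift.{u + 1} (max ξ.1 Ordinal.omega0).card := by
    intro ξ
    have hm : max ξ.1 Ordinal.omega0 < μ.ord := max_lt ξ.2 hω
    rw [← Cardinal.mk_Iio_ordinal]
    refine Cardinal.mk_congr
      ⟨fun β => ⟨b β, β.2⟩, fun ζ => ⟨b.symm ⟨ζ.1, ζ.2.trans hm⟩, ?_⟩, ?_, ?_⟩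
    · change ((b (b.symm _) : Iio μ.ord) : Ordinal.{u}) < _
      rw [Equiv.apply_symm_apply]
      exact ζ.2
    · intro β
      exact Subtype.ext (b.symm_apply_apply _)
    · intro ζ
      simp
  have hfil : ∀ ξ, ∃ F, IsGluingFilter U (d ξ) F := fun ξ => by
    refine exists_isGluingFilter_of_hasGPBelow hκ hGP U hU (d ξ) ?_ ?_
    · rw [hd, Cardinal.aleph0_le_lift, Ordinal.aleph0_le_card]
      exact le_max_right _ _
    · rw [hd, Cardinal.lift_lt, ← Cardinal.lt_ord]
      exact max_lt ξ.2 hω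
  choose F hF using hfil
  have hbig : ∀ β, ∀ᶠ ξ in (D : Filter (Iio μ.ord)), β ∈ d ξ := fun β =>
    Filter.mem_of_superset (Ioi_mem hμ0.le hD (b β)) fun ξ hξ => by
      change (b β : Ordinal.{u}) < max ξ.1 Ordinal.omega0
      exact lt_max_of_lt_left hξ
  -- The limit along `D`: a set belongs if it is in `F ξ` for `D`-almost all `ξ`. Completeness of
  -- `D` for families smaller than `κ` follows from `κ ≤ μ`.
  have hglue : IsGluingFilter U univ (Filter.bind D F) := by
    have hDμ := hD.2
    have hDκ := CardinalInterFilter.of_cardinalInterFilter_of_le (D : Filter (Iio μ.ord))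
      (Cardinal.lift_le.{u + 1}.2 hκμ)
    refine ⟨⟨fun hbot => ?_⟩, ⟨fun S hS h => ?_⟩, fun c hc X hX => ?_, fun β _ X hX => ?_,
      fun β _ γ _ hβγ => ?_⟩
    · have h1 : ∅ ∈ Filter.bind (D : Filter (Iio μ.ord)) F := by rw [hbot]; trivial
      obtain ⟨ξ, hξ⟩ := Filter.nonempty_of_mem (Filter.mem_bind'.1 h1)
      have := (hF ξ).neBot
      exact Filter.empty_notMem _ hξ
    · refine Filter.mem_bind'.2 ?_
      have h1 : ∀ᶠ ξ in (D : Filter (Iio μ.ord)), ∀ s : S, s.1 ∈ F ξ :=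
        (Filter.eventually_cardinal_forall hS).2 fun s => Filter.mem_bind'.1 (h s.1 s.2)
      refine h1.mono fun ξ hξ => ?_
      exact (hF ξ).complete.cardinal_sInter_mem S hS fun s hs => hξ ⟨s, hs⟩
    -- Each `F ξ` decides `X` even if its support is not inside `d ξ`, and the ultrafilter `D`
    -- selects one of the two verdicts.
    · have h1 : ∀ᶠ ξ in (D : Filter (Iio μ.ord)), X ∈ F ξ ∨ Xᶜ ∈ F ξ :=
        Filter.Eventually.of_forall fun ξ => (hF ξ).ultra c hc X hX
      exact (Ultrafilter.eventually_or.1 h1).imp Filter.mem_bind'.2 Filter.mem_bind'.2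
    · exact Filter.mem_bind'.2 ((hbig β).mono fun ξ hξ => (hF ξ).mem β hξ X hX)
    · exact Filter.mem_bind'.2 (((hbig β).and (hbig γ)).mono fun ξ hξ =>
        (hF ξ).lt β hξ.1 γ hξ.2 hβγ)
  exact hglue.exists_embedding hκ (Ordinal.omega0_pos.trans_le hα0) fun β => (hU β).1

end Gluing

theorem mainTheorem9 :
    (∀ κ μ : Cardinal.{u}, Gluing.IsMeasurableCardinal κ → Gluing.IsMeasurableCardinal μ → κ ≤ μ →
      Gluing.HasGPBelow κ μ.ord → Gluing.HasGPBelow κ (Order.succ μ).ord) ∧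
    (∀ κ : Cardinal.{u}, Gluing.IsMeasurableCardinal κ →
      Gluing.HasGPBelow κ κ.ord → Gluing.HasGPBelow κ (Order.succ κ).ord) :=
  ⟨fun _ _ hκ hμ h hGP => Gluing.hasGPBelow_succ hκ.1 hμ h hGP,
    fun _ hκ hGP => Gluing.hasGPBelow_succ hκ.1 hκ le_rfl hGP⟩
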